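/- Let $\mathcal X$ be a real Hilbert space and let $g:\mathcal X\to\mathbb R$ be convex and differentiable with $\operatorname{argmin} g\neq\emptyset$. Let $\alpha,\beta,a,t_0>0$, $0<q<1$ and $q<p<q+1$. Let $\delta:[t_0,+\infty)\to(0,+\infty)$ be a non-decreasing differentiable function with $\lim_{t\to+\infty}\delta(t)=+\infty$ such that, for all sufficiently large $t$, $$t^p\dot\delta(t)+p\,t^{p-1}\delta(t)-a\beta\ \ge\ 0,$$ and such that, for some constant $K_1>0$, $t\dot\delta(t)<K_1\delta(t)$ for all sufficiently large $t$. Let $x:[t_0,+\infty)\to\mathcal X$ be a global solution, that is, a twice differentiable trajectory along which $\nabla^2 g$ exists and which satisfies, for all $t\ge t_0$, $$\ddot x(t)+\frac{\alpha}{t^q}\dot x(t)+\beta\nabla^2 g(x(t))\dot x(t)+\delta(t)\nabla g(x(t))+\frac{a}{t^p}x(t)=0 .$$ Then $g$ has a unique minimizer of minimal norm $\bar x^*=\operatorname{proj}_{\operatorname{argmin} g}0$; for every $t\ge t_0$ the function $g_t(z)=g(z)+\frac{a}{2\delta(t)t^p}\|z\|^2$ has a unique minimizer $x_t$ on $\mathcal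 X$; and the following hold. (i) $x(t)$ converges strongly to $\bar x^*$, that is, $\lim_{t\to+\infty}\|x(t)-\bar x^*\|=0$. (ii) If $q<p<\frac12(3q+1)$, then, as $t\to+\infty$, $$\|\dot x(t)+\beta\nabla g(x(t))\|=\mathcal O\!\left(t^{-\frac{p+1-\max\{q,p-q\}}{2}}\right),\qquad \|x(t)-x_t\|=\mathcal O\!\left(t^{-\frac{1-q}{2}}\right),\qquad g(x(t))-g(\bar x^*)=\mathcal O\!\left(\frac{1}{\delta(t)t^p}\right).$$ (iii) If $\frac12(3q+1)\le p<q+1$, then, as $t\to+\infty$, $$\|\dot x(t)+\beta\nabla g(x(t))\|=\mathcal O\!\left(\frac1{t^{2q-p+1}}\right),\qquad \|x(t)-x_t\|=\mathcal O\!\left(\frac1{t^{q-p+1}}\right).$$ If moreover $p\le\frac13(4q+2)$, then $g(x(t))-g(\bar x^*)=\mathcal O\!\left(\frac{1}{\delta(t)t^p}\right)$; if instead $\frac13(4q+2)<p<q+1$, then $g(x(t))-g(\bar x^*)=\mathcal O\!\left(\frac{1}{\delta(t)t^{4q-2p+2}}\right)$. -/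

import Mathlib

open Set Filter Topology Asymptotics

noncomputable section

namespace TikhonovHessian

/-- Time derivative on the half-line `[t₀, +∞)` (one-sided at the initial time `t₀`). -/
def timeDeriv {E : Type*} [NormedAddCommGroup E] [NormedSpace ℝ E]
    (t₀ : ℝ) (f : ℝ → E) (t : ℝ) : E :=
  derivWithin f (Ici t₀) t

variable {X : Type*} [NormedAddCommGroup X] [InnerProductSpace ℝ X] [CompleteSpace X]

/-- The Hessian of `g` at `z`: the Fréchet derivative at `z` of the gradient map. -/
def hessian (g : X → ℝ) (z : X) : X →L[ℝ] X :=
  fderiv ℝ (gradient g) z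

/-- `x` is a global solution on `[t₀, +∞)` of
`x'' + (α / t^q) x' + β ∇²g(x) x' + δ(t) ∇g(x) + (a / t^p) x = 0`.
The trajectory is twice differentiable, and the Hessian in the equation exists along it. -/
structure IsGlobalSolution (g : X → ℝ) (α β a p q t₀ : ℝ) (δ : ℝ → ℝ) (x : ℝ → X) : Prop where
  differentiable : DifferentiableOn ℝ x (Ici t₀)
  differentiable_velocity : DifferentiableOn ℝ (timeDeriv t₀ x) (Ici t₀)
  differentiable_gradient : ∀ t, t₀ ≤ t → DifferentiableAt ℝ (gradient g) (x t)
  equation : ∀ t, t₀ ≤ t →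
    timeDeriv t₀ (timeDeriv t₀ x) t + (α / t ^ q) • timeDeriv t₀ x t
      + β • hessian g (x t) (timeDeriv t₀ x t)
      + δ t • gradient g (x t) + (a / t ^ p) • x t = 0

/-- The set of global minimizers of `g`. -/
def argmin {Y : Type*} (g : Y → ℝ) : Set Y :=
  {z | ∀ y, g z ≤ g y}

/-- `z` is an element of minimal norm of `argmin g`, that is, the projection of `0` onto it. -/
def IsMinNormMinimizer (g : X → ℝ) (z : X) : Prop :=
  z ∈ argmin g ∧ ∀ y ∈ argmin g, ‖z‖ ≤ ‖y‖

/-- The Tikhonov regularized function `g_t(z) = g(z) + a / (2 δ(t) t^p) * ‖z‖²`. -/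
def regularized (g : X → ℝ) (a p : ℝ) (δ : ℝ → ℝ) (t : ℝ) (z : X) : ℝ :=
  g z + a / (2 * δ t * t ^ p) * ‖z‖ ^ 2

end TikhonovHessian

end

/-! With `v = x' + β∇g(x)` the Hessian term becomes part of `v'`, and the equation reads `v' = -γ x'
- δ(∇g(x) + ε x)`, where `γ = α t^(-q)` and `ε = a / (δ t^p)`. Let `z(t)` be the minimizer of `g_t =
g + (ε/2)‖·‖²` and `w = x - z`. The energy `E = δ(g_t(x) - g_t(z)) + ‖v‖²/2 + (γ/2)⟨v, w⟩ +
(γ²/4)‖w‖²` is chosen so that the indefinite cross terms of its derivative cancel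
(`dissipation_identity`).

The path `z` is not known to be differentiable, only Lipschitz in `ε` (`norm_sub_le_of_le`). So `E`
is touched from above at each `t` by `frozenEnergy`, which keeps `z(t)` fixed and pays for the drift
of the path. Its right derivative bounds the lower right Dini derivative of `E`. By
`dissipation_inequality`, this gives `E' ≤ -c t^(-m) E + C t^(-(k+m))` in the Dini sense, for `max q
(p-q) ≤ m < 1` and `k + m ≤ min(p+1, q+2, 3q+2-p)`. Comparison with `A t^(-k)` yields `E =
O(t^(-k))` (`exists_le_rpow_of_dissipation`).

All rates are read off from `E`: it dominates `‖v‖²`, `γ²‖w‖²`, the gap `δ(g_t(x) - g_t(z))` and, by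
strong convexity, `δε‖w‖²`, up to constants. The two regimes of `p` correspond to whether `p+1` or
`3q+2-p` is the binding exponent. Strong convergence follows because `‖x - z‖ → 0` and the Tikhonov
path tends to the minimizer of least norm (`tendsto_tikhonov`). -/

namespace TikhonovHessian

/-! ### Tikhonov regularization: existence, uniqueness, stability and limit of the path. -/

section Tikhonov

variable {X : Type*} [NormedAddCommGroup X] [InnerProductSpace ℝ X]

theorem norm_sq_convex_combination (s : ℝ) (u w : X) :
    ‖(1 - s) • u + s • w‖ ^ 2
      = (1 - s) * ‖u‖ ^ 2 + s * ‖w‖ ^ 2 - s * (1 - s) * ‖w - u‖ ^ 2 := by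
  rw [norm_add_sq_real, norm_sub_sq_real, norm_smul, norm_smul, real_inner_smul_left,
    real_inner_smul_right, mul_pow, mul_pow, Real.norm_eq_abs, Real.norm_eq_abs, sq_abs, sq_abs,
    real_inner_comm w u]
  ring

/-- The quadratic growth of a Tikhonov regularized convex function at its minimizer. -/
theorem add_norm_sq_le_of_mem_argmin {g : X → ℝ} (hg : ConvexOn ℝ univ g) {c : ℝ} {z : X}
    (hz : z ∈ argmin (fun u => g u + c * ‖u‖ ^ 2)) (u : X) :
    g z + c * ‖z‖ ^ 2 + c * ‖u - z‖ ^ 2 ≤ g u + c * ‖u‖ ^ 2 := by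
  -- Minimality is tested at the point a fraction `s` of the way to `u`; divide by `s` and let `s →
  -- 0`.
  have key : ∀ s ∈ Ioo (0 : ℝ) 1,
      g z + c * ‖z‖ ^ 2 + c * (1 - s) * ‖u - z‖ ^ 2 ≤ g u + c * ‖u‖ ^ 2 := by
    rintro s ⟨hs0, hs1⟩
    have h1 := hz ((1 - s) • z + s • u)
    have h2 := hg.2 (mem_univ z) (mem_univ u) (sub_nonneg.2 hs1.le) hs0.le (by ring)
    simp only [smul_eq_mul] at h1 h2
    rw [norm_sq_convex_combination] at h1
    have h3 : s * (g z + c * ‖z‖ ^ 2 + c * (1 - s) * ‖u - z‖ ^ 2)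
        ≤ s * (g u + c * ‖u‖ ^ 2) := by nlinarith
    exact le_of_mul_le_mul_left h3 hs0
  have hlim : Tendsto (fun s : ℝ => g z + c * ‖z‖ ^ 2 + c * (1 - s) * ‖u - z‖ ^ 2) (𝓝[>] 0)
      (𝓝 (g z + c * ‖z‖ ^ 2 + c * ‖u - z‖ ^ 2)) := by
    have : Continuous (fun s : ℝ => g z + c * ‖z‖ ^ 2 + c * (1 - s) * ‖u - z‖ ^ 2) := by fun_prop
    simpa using (this.tendsto 0).mono_left nhdsWithin_le_nhds
  refine le_of_tendsto hlim ?_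
  filter_upwards [Ioo_mem_nhdsGT (zero_lt_one' ℝ)] with s hs using key s hs

theorem eq_of_mem_argmin {g : X → ℝ} (hg : ConvexOn ℝ univ g) {c : ℝ} (hc : 0 < c) {z u : X}
    (hz : z ∈ argmin (fun u => g u + c * ‖u‖ ^ 2))
    (hu : u ∈ argmin (fun u => g u + c * ‖u‖ ^ 2)) : u = z := by
  have h1 := add_norm_sq_le_of_mem_argmin hg hz u
  have h2 : g u + c * ‖u‖ ^ 2 ≤ g z + c * ‖z‖ ^ 2 := hu z
  have h3 : ‖u - z‖ ^ 2 ≤ 0 := by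
    by_contra! h
    nlinarith [mul_pos hc h]
  have h4 : ‖u - z‖ = 0 := by
    have := sq_nonneg ‖u - z‖
    exact pow_eq_zero_iff two_ne_zero |>.1 (le_antisymm h3 this)
  exact sub_eq_zero.1 (norm_eq_zero.1 h4)

/-- Strong convexity at midpoints makes every minimizing sequence Cauchy, so completeness suffices
and no weak compactness is needed. -/
theorem exists_mem_argmin [CompleteSpace X] {g : X → ℝ} (hg : ConvexOn ℝ univ g)
    (hgc : Continuous g) (hne : (argmin g).Nonempty) {c : ℝ} (hc : 0 < c) :
    ∃ z, z ∈ argmin (fun u => g u + c * ‖u‖ ^ 2) := by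
  obtain ⟨y, hy⟩ := hne
  set f : X → ℝ := fun u => g u + c * ‖u‖ ^ 2 with hf
  have hfc : Continuous f := by fun_prop
  have hbdd : BddBelow (range f) := by
    refine ⟨g y, ?_⟩
    rintro _ ⟨u, rfl⟩
    have : 0 ≤ c * ‖u‖ ^ 2 := by positivity
    have := hy u
    simp only [hf]; linarith
  set m := ⨅ u, f u
  have hm : ∀ u, m ≤ f u := fun u => ciInf_le hbdd u
  have hmid : ∀ u w, c / 4 * ‖w - u‖ ^ 2 ≤ (f u - m) / 2 + (f w - m) / 2 := by
    intro u w
    have h1 := hm ((1 - (1 / 2 : ℝ)) • u + (1 / 2 : ℝ) • w)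
    have h2 := hg.2 (mem_univ u) (mem_univ w) (show (0 : ℝ) ≤ 1 - 1 / 2 by norm_num)
      (show (0 : ℝ) ≤ 1 / 2 by norm_num) (by ring)
    simp only [hf, smul_eq_mul] at h1 h2 ⊢
    rw [norm_sq_convex_combination] at h1
    nlinarith
  have hex : ∀ n : ℕ, ∃ u, f u < m + 1 / ((n : ℝ) + 1) := fun n =>
    exists_lt_of_ciInf_lt (lt_add_of_pos_right _ (by positivity))
  choose u hu using hex
  have hlim0 : Tendsto (fun n : ℕ => 1 / ((n : ℝ) + 1)) atTop (𝓝 0) :=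
    tendsto_one_div_add_atTop_nhds_zero_nat
  have hcau : CauchySeq u := by
    rw [Metric.cauchySeq_iff']
    intro e he
    have h1 : ∀ᶠ n : ℕ in atTop, 1 / ((n : ℝ) + 1) < c / 4 * e ^ 2 :=
      hlim0.eventually_lt_const (by positivity)
    obtain ⟨N, hN⟩ := h1.exists
    refine ⟨N, fun n hn => ?_⟩
    rw [dist_eq_norm]
    have h2 := hmid (u N) (u n)
    have h3 : 1 / ((n : ℝ) + 1) ≤ 1 / ((N : ℝ) + 1) := by
      apply one_div_le_one_div_of_le (by positivity)
      have : (N : ℝ) ≤ n := by exact_mod_cast hn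
      linarith
    have h4 : c / 4 * ‖u n - u N‖ ^ 2 < c / 4 * e ^ 2 := by linarith [hu n, hu N]
    exact lt_of_pow_lt_pow_left₀ 2 he.le (lt_of_mul_lt_mul_left h4 (by positivity))
  obtain ⟨z, hz⟩ := cauchySeq_tendsto_of_complete hcau
  refine ⟨z, fun w => ?_⟩
  have h1 : f z ≤ m + 0 :=
    le_of_tendsto_of_tendsto ((hfc.tendsto z).comp hz) (tendsto_const_nhds.add hlim0)
      (Eventually.of_forall fun n => (hu n).le)
  have := hm w
  change f z ≤ f w
  linarith

theorem isClosed_argmin {X : Type*} [TopologicalSpace X] {g : X → ℝ} (hgc : Continuous g) :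
    IsClosed (argmin g) := by
  have : argmin g = ⋂ y, {z | g z ≤ g y} := by ext; simp [argmin]
  rw [this]
  exact isClosed_iInter fun y => isClosed_le hgc continuous_const

theorem convex_argmin {g : X → ℝ} (hg : ConvexOn ℝ univ g) : Convex ℝ (argmin g) := by
  have : argmin g = ⋂ y, {z | z ∈ univ ∧ g z ≤ g y} := by ext; simp [argmin]
  rw [this]
  exact convex_iInter fun y => hg.convex_le _

theorem IsMinNormMinimizer.eq {g : X → ℝ} (hg : ConvexOn ℝ univ g) {z u : X}
    (hz : IsMinNormMinimizer g z) (hu : IsMinNormMinimizer g u) : u = z := by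
  have h1 := hz.2 _ (convex_argmin hg hz.1 hu.1 (a := 1 - (1 / 2 : ℝ)) (b := 1 / 2) (by norm_num)
      (by norm_num) (by ring))
  have h2 : ‖u‖ ^ 2 ≤ ‖z‖ ^ 2 := pow_le_pow_left₀ (norm_nonneg _) (hu.2 z hz.1) 2
  have h3 := pow_le_pow_left₀ (norm_nonneg _) h1 2
  rw [norm_sq_convex_combination] at h3
  have h4 : ‖u - z‖ = 0 :=
    pow_eq_zero_iff two_ne_zero |>.1 (le_antisymm (by linarith) (sq_nonneg ‖u - z‖))
  exact sub_eq_zero.1 (norm_eq_zero.1 h4)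

theorem exists_isMinNormMinimizer [CompleteSpace X] {g : X → ℝ} (hg : ConvexOn ℝ univ g)
    (hgc : Continuous g) (hne : (argmin g).Nonempty) : ∃ z, IsMinNormMinimizer g z := by
  obtain ⟨z, hz, hz'⟩ := exists_norm_eq_iInf_of_complete_convex hne
    (isClosed_argmin hgc).isComplete (convex_argmin hg) 0
  refine ⟨z, hz, fun y hy => ?_⟩
  have h : (⨅ w : argmin g, ‖(0 : X) - w‖) ≤ ‖(0 : X) - y‖ :=
    ciInf_le (f := fun w : argmin g => ‖(0 : X) - w‖)
      ⟨0, by rintro _ ⟨w, rfl⟩; exact norm_nonneg _⟩ ⟨y, hy⟩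
  rw [← hz'] at h
  simpa using h

theorem norm_le_of_mem_argmin {X : Type*} [NormedAddCommGroup X] {g : X → ℝ} {c : ℝ}
    (hc : 0 < c) {z y : X}
    (hz : z ∈ argmin (fun u => g u + c * ‖u‖ ^ 2)) (hy : y ∈ argmin g) : ‖z‖ ≤ ‖y‖ := by
  have h1 : g z + c * ‖z‖ ^ 2 ≤ g y + c * ‖y‖ ^ 2 := hz y
  have h2 := hy z
  have h3 : c * ‖z‖ ^ 2 ≤ c * ‖y‖ ^ 2 := by linarith
  exact (pow_le_pow_iff_left₀ (norm_nonneg _) (norm_nonneg _) two_ne_zero).1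
    (le_of_mul_le_mul_left h3 hc)

/-- Comparison of the minimizers `z`, `z'` for two regularization parameters `c' ≤ c`. -/
theorem mul_norm_sub_sq_le {g : X → ℝ} (hg : ConvexOn ℝ univ g) {c c' : ℝ} {z z' : X}
    (hz : z ∈ argmin (fun u => g u + c * ‖u‖ ^ 2))
    (hz' : z' ∈ argmin (fun u => g u + c' * ‖u‖ ^ 2)) :
    (c + c') * ‖z' - z‖ ^ 2 ≤ (c - c') * (‖z'‖ ^ 2 - ‖z‖ ^ 2) := by
  have h1 := add_norm_sq_le_of_mem_argmin hg hz z'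
  have h2 := add_norm_sq_le_of_mem_argmin hg hz' z
  rw [norm_sub_rev z z'] at h2
  linarith

/-- Along the path the norm grows as the parameter decreases, and this growth controls the
displacement. A bounded norm therefore forces the path to be Cauchy. -/
theorem norm_sub_sq_le_of_le {g : X → ℝ} (hg : ConvexOn ℝ univ g) {c c' : ℝ} (hc' : 0 < c')
    (hcc : c' ≤ c) {z z' : X} (hz : z ∈ argmin (fun u => g u + c * ‖u‖ ^ 2))
    (hz' : z' ∈ argmin (fun u => g u + c' * ‖u‖ ^ 2)) :
    ‖z' - z‖ ^ 2 ≤ ‖z'‖ ^ 2 - ‖z‖ ^ 2 := by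
  have h := mul_norm_sub_sq_le hg hz hz'
  have h0 := sq_nonneg ‖z' - z‖
  by_contra! hlt
  rcases le_or_gt 0 (‖z'‖ ^ 2 - ‖z‖ ^ 2) with h1 | h1
  · nlinarith [mul_le_mul_of_nonneg_left hlt.le (sub_nonneg.2 hcc)]
  · have hpos : 0 < ‖z' - z‖ ^ 2 := by
      rcases h0.lt_or_eq with h2 | h2
      · exact h2
      · have : z' = z := sub_eq_zero.1 (norm_eq_zero.1 (pow_eq_zero_iff two_ne_zero |>.1 h2.symm))
        simp [this] at h1
    nlinarith [mul_pos hc' hpos, mul_nonneg (sub_nonneg.2 hcc) (neg_nonneg.2 h1.le)]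

/-- Quantitative substitute for the bound `‖z'‖ ≤ (-ε'/ε)‖z‖` on the velocity of the path, with no
differentiability required. -/
theorem norm_sub_le_of_le {g : X → ℝ} (hg : ConvexOn ℝ univ g) {c c' : ℝ} (hc' : 0 < c')
    (hcc : c' ≤ c) {z z' : X} (hz : z ∈ argmin (fun u => g u + c * ‖u‖ ^ 2))
    (hz' : z' ∈ argmin (fun u => g u + c' * ‖u‖ ^ 2)) :
    ‖z' - z‖ ≤ (c - c') / c * ‖z'‖ := by
  have h := mul_norm_sub_sq_le hg hz hz'
  have hc : 0 < c := hc'.trans_le hcc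
  have e : ‖z‖ ^ 2 = ‖z'‖ ^ 2 - 2 * inner ℝ z' (z' - z) + ‖z' - z‖ ^ 2 := by
    have := norm_sub_sq_real z' (z' - z)
    rwa [sub_sub_cancel] at this
  rw [e] at h
  have h2 := real_inner_le_norm z' (z' - z)
  rcases (norm_nonneg (z' - z)).eq_or_lt with h0 | h0
  · rw [← h0]
    exact mul_nonneg (div_nonneg (sub_nonneg.2 hcc) hc.le) (norm_nonneg _)
  · rw [div_mul_eq_mul_div, le_div_iff₀ hc]
    have h3 : c * ‖z' - z‖ ^ 2 ≤ (c - c') * (‖z'‖ * ‖z' - z‖) := by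
      nlinarith [mul_le_mul_of_nonneg_left h2 (sub_nonneg.2 hcc)]
    refine le_of_mul_le_mul_right ?_ h0
    linarith

/-- The Tikhonov path converges strongly to the minimizer of minimal norm. -/
theorem tendsto_tikhonov [CompleteSpace X] {g : X → ℝ} (hg : ConvexOn ℝ univ g)
    (hgc : Continuous g) {xbar : X} (hxbar : IsMinNormMinimizer g xbar) {c : ℝ → ℝ} {t₀ : ℝ}
    (hc : ∀ t, t₀ ≤ t → 0 < c t) (hanti : AntitoneOn c (Ici t₀)) (hc0 : Tendsto c atTop (𝓝 0))
    {z : ℝ → X} (hz : ∀ t, t₀ ≤ t → z t ∈ argmin (fun u => g u + c t * ‖u‖ ^ 2)) :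
    Tendsto z atTop (𝓝 xbar) := by
  have hle : ∀ t, t₀ ≤ t → ‖z t‖ ≤ ‖xbar‖ := fun t ht =>
    norm_le_of_mem_argmin (hc t ht) (hz t ht) hxbar.1
  have hd : ∀ t s, t₀ ≤ t → t ≤ s → ‖z s - z t‖ ^ 2 ≤ ‖z s‖ ^ 2 - ‖z t‖ ^ 2 := fun t s ht hs =>
    norm_sub_sq_le_of_le hg (hc s (ht.trans hs)) (hanti ht (ht.trans hs) hs) (hz t ht)
      (hz s (ht.trans hs))
  have hbdd : BddAbove ((fun t => ‖z t‖ ^ 2) '' Ici t₀) := by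
    refine ⟨‖xbar‖ ^ 2, ?_⟩
    rintro _ ⟨t, ht, rfl⟩
    exact pow_le_pow_left₀ (norm_nonneg _) (hle t ht) 2
  have hcau : Cauchy (map z atTop) := by
    refine Metric.cauchy_iff.2 ⟨inferInstance, fun e he => ?_⟩
    have hne : ((fun t => ‖z t‖ ^ 2) '' Ici t₀).Nonempty := ⟨_, t₀, self_mem_Ici, rfl⟩
    -- From this `t` on, `‖z‖²` can increase by less than `(e/2)²`, so the path stays within `e/2`
    -- of `z t`.
    obtain ⟨_, ⟨t, ht, rfl⟩, hlt⟩ := exists_lt_of_lt_csSup hne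
      (sub_lt_self (sSup ((fun t => ‖z t‖ ^ 2) '' Ici t₀)) (show 0 < (e / 2) ^ 2 by positivity))
    have key : ∀ s, t ≤ s → ‖z s - z t‖ < e / 2 := by
      intro s hs
      have h1 := hd t s ht hs
      have h2 := le_csSup hbdd ⟨s, le_trans ht hs, rfl⟩
      simp only at h2 hlt
      exact lt_of_pow_lt_pow_left₀ 2 (by positivity) (by linarith)
    refine ⟨z '' Ici t, image_mem_map (Ici_mem_atTop t), ?_⟩
    rintro _ ⟨s, hs, rfl⟩ _ ⟨s', hs', rfl⟩
    have h1 := key s hs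
    have h2 := key s' hs'
    rw [← dist_eq_norm] at h1 h2
    linarith [dist_triangle_right (z s) (z s') (z t)]
  obtain ⟨y, hy⟩ := CompleteSpace.complete hcau
  have hy : Tendsto z atTop (𝓝 y) := hy
  have hyle : ‖y‖ ≤ ‖xbar‖ := le_of_tendsto hy.norm (by
    filter_upwards [eventually_ge_atTop t₀] with t ht using hle t ht)
  have hgy : g y ≤ g xbar := by
    have h1 : Tendsto (fun t => g xbar + c t * ‖xbar‖ ^ 2) atTop (𝓝 (g xbar + 0 * ‖xbar‖ ^ 2)) :=
      tendsto_const_nhds.add (hc0.mul tendsto_const_nhds)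
    rw [zero_mul, add_zero] at h1
    refine le_of_tendsto_of_tendsto ((hgc.tendsto y).comp hy) h1 ?_
    filter_upwards [eventually_ge_atTop t₀] with t ht
    have h2 : g (z t) + c t * ‖z t‖ ^ 2 ≤ g xbar + c t * ‖xbar‖ ^ 2 := hz t ht xbar
    have h3 : 0 ≤ c t * ‖z t‖ ^ 2 := mul_nonneg (hc t ht).le (sq_nonneg _)
    simp only [Function.comp]
    linarith
  have hymin : IsMinNormMinimizer g y :=
    ⟨fun w => hgy.trans (hxbar.1 w), fun w hw => hyle.trans (hxbar.2 w hw)⟩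
  rwa [← hxbar.eq hg hymin]

theorem add_inner_gradient_le [CompleteSpace X] {g : X → ℝ} (hg : ConvexOn ℝ univ g)
    (hd : Differentiable ℝ g) (u w : X) : g u + inner ℝ (gradient g u) (w - u) ≤ g w := by
  have hc : ConvexOn ℝ univ (g ∘ AffineMap.lineMap (k := ℝ) u w) := by
    simpa using hg.comp_affineMap (AffineMap.lineMap (k := ℝ) u w)
  have hder : HasDerivAt (g ∘ AffineMap.lineMap (k := ℝ) u w)
      (inner ℝ (gradient g u) (w - u)) 0 := by
    rw [inner_gradient_left]
    have h1 : HasFDerivAt g (fderiv ℝ g u) (AffineMap.lineMap (k := ℝ) u w 0) := by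
      simpa using (hd u).hasFDerivAt
    exact h1.comp_hasDerivAt 0 AffineMap.hasDerivAt_lineMap
  have := hc.le_slope_of_hasDerivAt (mem_univ 0) (mem_univ 1) zero_lt_one hder
  simp only [slope_def_field, Function.comp, AffineMap.lineMap_apply_one,
    AffineMap.lineMap_apply_zero, sub_zero, div_one] at this
  linarith

end Tikhonov

end TikhonovHessian

namespace TikhonovHessian

/-! ### Comparison principle for lower right Dini derivatives. -/

section Comparison

theorem frequently_slope_lt_of_le {f U : ℝ → ℝ} {u r t : ℝ}
    (hU : HasDerivWithinAt U u (Ici t) t) (hle : ∀ s, t ≤ s → f s ≤ U s) (heq : f t = U t)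
    (hr : u < r) : ∃ᶠ s in 𝓝[>] t, slope f t s < r := by
  refine ((hU.liminf_right_slope_le hr).and_eventually self_mem_nhdsWithin).mono ?_
  rintro s ⟨hs, hts⟩
  refine lt_of_le_of_lt ?_ hs
  have hts : t < s := hts
  rw [slope_def_field, slope_def_field, heq]
  exact div_le_div_of_nonneg_right (sub_le_sub_right (hle s hts.le) _) (sub_pos.2 hts).le

/-- A Grönwall-type estimate with decay rate `c t^(-m)`, `m < 1`, and forcing `C t^(-(k+m))`. -/
theorem exists_le_rpow_of_dissipation {f f' : ℝ → ℝ} {c C m k T : ℝ} (hc : 0 < c) (hC : 0 ≤ C)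
    (hm : m < 1) (hf : ContinuousOn f (Ici T))
    (hf' : ∀ t, T ≤ t → ∀ r, f' t < r → ∃ᶠ s in 𝓝[>] t, slope f t s < r)
    (hbound : ∀ t, T ≤ t → f' t ≤ -(c * t ^ (-m)) * f t + C * t ^ (-(k + m))) :
    ∃ B T', 0 < B ∧ ∀ t, T' ≤ t → f t ≤ B * t ^ (-k) := by
  have hlim : Tendsto (fun t : ℝ => t ^ (-(1 - m))) atTop (𝓝 0) :=
    tendsto_rpow_neg_atTop (by linarith)
  -- Since `m < 1`, the decay of the barrier is eventually slower than half the dissipation; `|k| +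
  -- 1` covers every sign of `k`, including zero.
  have hk : 0 < c / (2 * (|k| + 1)) := by positivity
  obtain ⟨T₁, hT₁⟩ := eventually_atTop.1 (hlim.eventually_le_const hk)
  set S := max T (max T₁ 1) with hS
  have hST : T ≤ S := le_max_left _ _
  have hST₁ : T₁ ≤ S := (le_max_left _ _).trans (le_max_right _ _)
  have hS1 : 1 ≤ S := (le_max_right _ _).trans (le_max_right _ _)
  have hS0 : 0 < S := by linarith
  -- The first entry makes the barrier inequality strict at a contact point, even if `C = 0`; the
  -- second places the barrier above `f` at `S`.
  set A := max (2 * C / c + 1) (f S * S ^ k) with hA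
  have hA1 : 2 * C / c + 1 ≤ A := le_max_left _ _
  have hA0 : 0 < A := lt_of_lt_of_le (by positivity) hA1
  refine ⟨A, S, hA0, fun t ht => ?_⟩
  have hder : ∀ s, 0 < s → HasDerivAt (fun s : ℝ => A * s ^ (-k)) (A * (-k * s ^ (-k - 1))) s :=
    fun s hs => (Real.hasDerivAt_rpow_const (Or.inl hs.ne')).const_mul A
  refine image_le_of_liminf_slope_right_lt_deriv_boundary' (a := S) (b := t) (f := f) (f' := f')
    (B := fun s => A * s ^ (-k)) (B' := fun s => A * (-k * s ^ (-k - 1)))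
    (hf.mono fun s hs => hST.trans hs.1) (fun s hs => hf' s (hST.trans hs.1)) ?_
    (fun s hs => (hder s (hS0.trans_le hs.1)).continuousAt.continuousWithinAt)
    (fun s hs => (hder s (hS0.trans_le hs.1)).hasDerivWithinAt) ?_ ⟨ht, le_rfl⟩
  · have h1 : f S * S ^ k ≤ A := le_max_right _ _
    have h2 := mul_le_mul_of_nonneg_right h1 (Real.rpow_nonneg hS0.le (-k))
    rwa [mul_assoc, ← Real.rpow_add hS0, add_neg_cancel, Real.rpow_zero, mul_one] at h2
  · intro s hs heq
    have hs0 : 0 < s := hS0.trans_le hs.1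
    refine (hbound s (hST.trans hs.1)).trans_lt ?_
    simp only [heq]
    set P := s ^ (-(k + m)) with hP
    have hP0 : 0 < P := Real.rpow_pos_of_pos hs0 _
    have e1 : s ^ (-m) * s ^ (-k) = P := by
      rw [hP, ← Real.rpow_add hs0]; congr 1; ring
    have e2 : s ^ (-k - 1) = s ^ (-(1 - m)) * P := by
      rw [hP, ← Real.rpow_add hs0]; congr 1; ring
    have h3 : s ^ (-(1 - m)) ≤ c / (2 * (|k| + 1)) := hT₁ s (hST₁.trans hs.1)
    have h4 : k * s ^ (-(1 - m)) ≤ c / 2 := by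
      have h5 : 0 ≤ s ^ (-(1 - m)) := Real.rpow_nonneg hs0.le _
      calc k * s ^ (-(1 - m)) ≤ (|k| + 1) * s ^ (-(1 - m)) :=
            mul_le_mul_of_nonneg_right (by linarith [le_abs_self k]) h5
        _ ≤ (|k| + 1) * (c / (2 * (|k| + 1))) := mul_le_mul_of_nonneg_left h3 (by positivity)
        _ = c / 2 := by field_simp
    have h6 : 2 * C + c ≤ c * A := by
      have := mul_le_mul_of_nonneg_left hA1 hc.le
      have e : c * (2 * C / c + 1) = 2 * C + c := by field_simp
      linarith
    have h7 : C < A * (c - k * s ^ (-(1 - m))) := by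
      nlinarith [mul_le_mul_of_nonneg_left h4 hA0.le]
    have h8 := mul_lt_mul_of_pos_right h7 hP0
    calc -(c * s ^ (-m)) * (A * s ^ (-k)) + C * P
        = -(c * A) * (s ^ (-m) * s ^ (-k)) + C * P := by ring
      _ = -(c * A) * P + C * P := by rw [e1]
      _ < A * (-k * s ^ (-k - 1)) := by rw [e2]; linarith

/-- A product is differentiable where one factor is continuous and the other one is differentiable
and vanishes. -/
theorem hasDerivWithinAt_mul_of_eq_zero {h D : ℝ → ℝ} {D' t : ℝ} {s : Set ℝ}
    (hD : HasDerivWithinAt D D' s t) (hD0 : D t = 0) (hh : ContinuousWithinAt h s t) :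
    HasDerivWithinAt (fun r => h r * D r) (h t * D') s t := by
  rw [hasDerivWithinAt_iff_tendsto_slope] at hD ⊢
  have h1 : Tendsto h (𝓝[s \ {t}] t) (𝓝 (h t)) := hh.mono_left (nhdsWithin_mono _ sdiff_subset)
  refine (h1.mul hD).congr fun r => ?_
  simp only [slope_def_field, hD0]
  ring

end Comparison

end TikhonovHessian

namespace TikhonovHessian

/-! ### The Lyapunov energy and its smooth majorant. -/

section Energy

variable {X : Type*} [NormedAddCommGroup X] [InnerProductSpace ℝ X]

/-- The Lyapunov energy of the trajectory `x`, with `v = x' + β ∇g(x)` and `z` the Tikhonov path. -/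
noncomputable def energy (g : X → ℝ) (δ γ ε : ℝ → ℝ) (x v z : ℝ → X) (t : ℝ) : ℝ :=
  δ t * ((g (x t) + ε t / 2 * ‖x t‖ ^ 2) - (g (z t) + ε t / 2 * ‖z t‖ ^ 2)) + 1 / 2 * ‖v t‖ ^ 2
    + γ t / 2 * inner ℝ (v t) (x t - z t) + γ t ^ 2 / 4 * ‖x t - z t‖ ^ 2

/-- The smooth majorant of the energy on `[t, +∞)` obtained by freezing the Tikhonov path at
time `t`. -/
noncomputable def frozenEnergy (g : X → ℝ) (δ γ ε : ℝ → ℝ) (x v : ℝ → X) (M : ℝ) (z : X)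
    (t s : ℝ) : ℝ :=
  δ s * ((g (x s) + ε s / 2 * ‖x s‖ ^ 2) - (g z + ε t / 2 * ‖z‖ ^ 2)) + 1 / 2 * ‖v s‖ ^ 2
    + γ s / 2 * inner ℝ (v s) (x s - z) + γ s ^ 2 / 4 * ‖x s - z‖ ^ 2
    + (δ s * (M ^ 2 / 2) * (ε t - ε s) + (γ s / 2 * ‖v s‖ + γ s ^ 2 / 2 * ‖x s - z‖
      + γ s ^ 2 / 4 * ((ε t - ε s) / ε t * M)) * ((ε t - ε s) / ε t * M))

theorem frozenEnergy_self (g : X → ℝ) (δ γ ε : ℝ → ℝ) (x v z : ℝ → X) (M t : ℝ) :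
    frozenEnergy g δ γ ε x v M (z t) t t = energy g δ γ ε x v z t := by
  simp [frozenEnergy, energy]

/-- Between times `t` and `s` the path moves by at most `D = ((ε t - ε s)/ε t) M`, and the minimal
value drops by at most `(ε t - ε s) M²/2`. The correction terms of `frozenEnergy` are these costs.
-/
theorem energy_le_frozenEnergy {g : X → ℝ} (hg : ConvexOn ℝ univ g) {δ γ ε : ℝ → ℝ}
    {x v z : ℝ → X} {M t s : ℝ} (hδ : 0 ≤ δ s) (hγ : 0 ≤ γ s) (hεs : 0 < ε s) (hε : ε s ≤ ε t)
    (hzt : z t ∈ argmin (fun u => g u + ε t / 2 * ‖u‖ ^ 2))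
    (hzs : z s ∈ argmin (fun u => g u + ε s / 2 * ‖u‖ ^ 2)) (hM : ‖z s‖ ≤ M) :
    energy g δ γ ε x v z s ≤ frozenEnergy g δ γ ε x v M (z t) t s := by
  have hεt : 0 < ε t := hεs.trans_le hε
  set D := (ε t - ε s) / ε t * M with hD
  have hd : ‖z s - z t‖ ≤ D := by
    refine (norm_sub_le_of_le hg (half_pos hεs) (by linarith) hzt hzs).trans ?_
    have e : (ε t / 2 - ε s / 2) / (ε t / 2) = (ε t - ε s) / ε t := by
      rw [← sub_div, div_div_div_cancel_right₀ two_ne_zero]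
    rw [e]
    exact mul_le_mul_of_nonneg_left hM (div_nonneg (by linarith) hεt.le)
  set d := z s - z t with hdd
  set w := x s - z t with hw
  have hy : x s - z s = w - d := by rw [hw, hdd]; abel
  have h1 : g (z t) + ε t / 2 * ‖z t‖ ^ 2 ≤ g (z s) + ε t / 2 * ‖z s‖ ^ 2 := hzt (z s)
  have h2 : ‖z s‖ ^ 2 ≤ M ^ 2 := pow_le_pow_left₀ (norm_nonneg _) hM 2
  have h3 : g (z t) + ε t / 2 * ‖z t‖ ^ 2 - (ε t - ε s) / 2 * M ^ 2
      ≤ g (z s) + ε s / 2 * ‖z s‖ ^ 2 := by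
    nlinarith [mul_le_mul_of_nonneg_left h2 (sub_nonneg.2 hε)]
  have h4 := mul_le_mul_of_nonneg_left h3 hδ
  have h5 : inner ℝ (v s) (w - d) ≤ inner ℝ (v s) w + ‖v s‖ * D := by
    rw [inner_sub_right]
    have := neg_le_of_abs_le (abs_real_inner_le_norm (v s) d)
    have := mul_le_mul_of_nonneg_left hd (norm_nonneg (v s))
    linarith
  have h6 : ‖w - d‖ ^ 2 ≤ ‖w‖ ^ 2 + 2 * ‖w‖ * D + D ^ 2 := by
    have := norm_sub_le w d
    have := pow_le_pow_left₀ (norm_nonneg _) (this.trans (add_le_add_right hd ‖w‖)) 2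
    linarith
  have h7 := mul_le_mul_of_nonneg_left h5 (div_nonneg hγ zero_le_two)
  have h8 := mul_le_mul_of_nonneg_left h6 (div_nonneg (sq_nonneg (γ s)) (zero_le_four (α := ℝ)))
  simp only [energy, frozenEnergy]
  rw [hy, ← hD, ← hw]
  linarith

theorem hasDerivWithinAt_frozenEnergy {g : X → ℝ} {δ γ ε : ℝ → ℝ} {x v : ℝ → X} {M t : ℝ} {z n : X}
    {δ' γ' ε' : ℝ} {x' v' : X} (hδ : HasDerivWithinAt δ δ' (Ici t) t)
    (hγ : HasDerivWithinAt γ γ' (Ici t) t) (hε : HasDerivWithinAt ε ε' (Ici t) t)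
    (hx : HasDerivWithinAt x x' (Ici t) t) (hv : HasDerivWithinAt v v' (Ici t) t)
    (hgx : HasDerivWithinAt (fun s => g (x s)) (inner ℝ n x') (Ici t) t) :
    HasDerivWithinAt (frozenEnergy g δ γ ε x v M z t)
      (δ' * ((g (x t) + ε t / 2 * ‖x t‖ ^ 2) - (g z + ε t / 2 * ‖z‖ ^ 2))
        + δ t * (inner ℝ n x' + (ε' / 2 * ‖x t‖ ^ 2 + ε t * inner ℝ (x t) x'))
        + inner ℝ (v t) v' + (γ' / 2 * inner ℝ (v t) (x t - z)
          + γ t / 2 * (inner ℝ (v t) x' + inner ℝ v' (x t - z)))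
        + (γ t * γ' / 2 * ‖x t - z‖ ^ 2 + γ t ^ 2 / 2 * inner ℝ (x t - z) x')
        + (δ t * (M ^ 2 / 2) * -ε'
          + (γ t / 2 * ‖v t‖ + γ t ^ 2 / 2 * ‖x t - z‖) * (-ε' / ε t * M))) (Ici t) t := by
  have hw : HasDerivWithinAt (fun s => x s - z) x' (Ici t) t := hx.sub_const z
  have hD1 : HasDerivWithinAt (fun s => ε t - ε s) (-ε') (Ici t) t := hε.const_sub _
  have hD2 : HasDerivWithinAt (fun s => (ε t - ε s) / ε t * M) (-ε' / ε t * M) (Ici t) t :=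
    (hD1.div_const _).mul_const _
  -- The corrections carry a factor vanishing at `s = t`, so their cofactors need only be
  -- continuous; `‖v‖` and `‖x - z‖` may fail to be differentiable.
  have c1 := hasDerivWithinAt_mul_of_eq_zero hD1 (sub_self _)
    (hδ.continuousWithinAt.mul_const (M ^ 2 / 2))
  have c2 := hasDerivWithinAt_mul_of_eq_zero hD2 (by simp)
    ((((hγ.continuousWithinAt.div_const 2).mul hv.continuousWithinAt.norm).add
      (((hγ.continuousWithinAt.pow 2).div_const 2).mul hw.continuousWithinAt.norm)).add
      (((hγ.continuousWithinAt.pow 2).div_const 4).mul hD2.continuousWithinAt))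
  have a1 := hδ.mul ((hgx.add ((hε.div_const 2).mul hx.norm_sq)).sub_const
    (g z + ε t / 2 * ‖z‖ ^ 2))
  have a2 := hv.norm_sq.const_mul (1 / 2 : ℝ)
  have a3 := (hγ.div_const 2).mul (hv.inner ℝ hw)
  have a4 := ((hγ.pow 2).div_const 4).mul hw.norm_sq
  have := ((((a1.add a2).add a3).add a4).add (c1.add c2))
  refine this.congr_deriv ?_
  simp
  ring

end Energy

/-! ### Dissipation of the energy: pointwise inequalities. -/

section Dissipation

variable {X : Type*} [NormedAddCommGroup X] [InnerProductSpace ℝ X]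

/-- The weight `δ` cancels the products of `v` with `n + εx`, and the coefficient `γ²/4` in the
energy cancels `⟨w, x'⟩`. -/
theorem dissipation_identity {δ γ ε β : ℝ} {x v n w x' v' : X} (hx' : x' = v - β • n)
    (hv' : v' = -(γ • x') - δ • (n + ε • x)) :
    δ * (inner ℝ n x' + ε * inner ℝ x x') + inner ℝ v v'
        + γ / 2 * (inner ℝ v x' + inner ℝ v' w) + γ ^ 2 / 2 * inner ℝ w x'
      = -(γ / 2) * ‖v‖ ^ 2 - β * δ * (‖n‖ ^ 2 + ε * inner ℝ x n)
        - γ / 2 * δ * (inner ℝ n w + ε * inner ℝ x w) + γ * β / 2 * inner ℝ v n := by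
  subst hv' hx'
  simp only [inner_sub_left, inner_sub_right, inner_add_left, inner_add_right, inner_neg_left,
    inner_neg_right, real_inner_smul_left, real_inner_smul_right, smul_sub, smul_add,
    real_inner_self_eq_norm_sq, real_inner_comm v n, real_inner_comm v x, real_inner_comm v w,
    real_inner_comm n x, real_inner_comm n w]
  ring

/-- Here `τ` stands for `1/t`. Young's inequality spends the available `-γ/2 ‖v‖²`, `-γδε/4 ‖w‖²`
and `-βδ‖n‖²` on the error terms. What remains is the dissipation on the right, plus three forcing
terms caused by the variation of `ε` and by the Hessian damping. -/
theorem dissipation_inequality {δ γ ε β τ K K₁ L M δ' γ' ε' gx gz : ℝ} {x v n z x' v' : X}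
    (hx' : x' = v - β • n) (hv' : v' = -(γ • x') - δ • (n + ε • x))
    (hδ : 0 < δ) (hγ : 0 < γ) (hε : 0 < ε) (hβ : 0 < β) (hM : ‖z‖ ≤ M)
    (hconv : gx + inner ℝ n (z - x) ≤ gz)
    (hmin : gz + ε / 2 * ‖z‖ ^ 2 ≤ gx + ε / 2 * ‖x‖ ^ 2)
    (hγβ : γ * β ≤ δ) (hδ' : δ' ≤ K₁ * τ * δ) (hK₁ : K₁ * τ ≤ γ / 4)
    (hε' : ε' ≤ 0) (hK : -ε' ≤ K * τ * ε) (hβε : β * ε ≤ L * τ) (hL : L * τ ≤ γ / 16)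
    (hγ'0 : γ' ≤ 0) (hγ' : -γ' ≤ γ * τ) (hτ : τ ^ 2 ≤ δ * ε / 16) :
    δ' * ((gx + ε / 2 * ‖x‖ ^ 2) - (gz + ε / 2 * ‖z‖ ^ 2))
        + δ * (inner ℝ n x' + (ε' / 2 * ‖x‖ ^ 2 + ε * inner ℝ x x'))
        + inner ℝ v v' + (γ' / 2 * inner ℝ v (x - z)
          + γ / 2 * (inner ℝ v x' + inner ℝ v' (x - z)))
        + (γ * γ' / 2 * ‖x - z‖ ^ 2 + γ ^ 2 / 2 * inner ℝ (x - z) x')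
        + (δ * (M ^ 2 / 2) * -ε'
          + (γ / 2 * ‖v‖ + γ ^ 2 / 2 * ‖x - z‖) * (-ε' / ε * M))
      ≤ -(γ / 8 * ‖v‖ ^ 2
          + γ / 4 * (δ * ((gx + ε / 2 * ‖x‖ ^ 2) - (gz + ε / 2 * ‖z‖ ^ 2)))
          + γ * (δ * ε) / 16 * ‖x - z‖ ^ 2)
        + (δ * ε * τ * ((K / 2 + L) * M ^ 2) + γ * τ ^ 2 * ((K * M) ^ 2 / 2)
          + γ ^ 3 * τ ^ 2 / (δ * ε) * (K * M) ^ 2) := by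
  have hM0 : 0 ≤ M := (norm_nonneg z).trans hM
  have hid := dissipation_identity (w := x - z) hx' hv'
  set w := x - z with hw
  set V := ‖v‖ with hV
  set W := ‖w‖ with hW
  set N := ‖n‖ with hN
  set Φ := (gx + ε / 2 * ‖x‖ ^ 2) - (gz + ε / 2 * ‖z‖ ^ 2) with hΦ
  have hV0 : 0 ≤ V := norm_nonneg _
  have hW0 : 0 ≤ W := norm_nonneg _
  have hN0 : 0 ≤ N := norm_nonneg _
  have hΦ0 : 0 ≤ Φ := by rw [hΦ]; linarith
  have hμ : 0 < δ * ε := mul_pos hδ hε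
  have t1 : inner ℝ v n ≤ V * N := real_inner_le_norm v n
  have t2 : -inner ℝ x n ≤ ‖x‖ * N := by
    linarith [neg_le_of_abs_le (abs_real_inner_le_norm x n)]
  have s1 : γ * β / 2 * inner ℝ v n ≤ γ / 8 * V ^ 2 + β * δ / 2 * N ^ 2 := by
    have h1 : γ * β / 2 * inner ℝ v n ≤ γ * β / 2 * (V * N) :=
      mul_le_mul_of_nonneg_left t1 (by positivity)
    have h2 : γ * β / 2 * (V * N) ≤ γ / 8 * V ^ 2 + γ * β ^ 2 / 2 * N ^ 2 := by
      have hsq := mul_nonneg hγ.le (sq_nonneg (V / 2 - β * N))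
      linarith
    have h3 : γ * β * (β / 2 * N ^ 2) ≤ δ * (β / 2 * N ^ 2) :=
      mul_le_mul_of_nonneg_right hγβ (by positivity)
    linarith
  have s2 : -(β * δ * (N ^ 2 + ε * inner ℝ x n))
      ≤ -(β * δ / 2 * N ^ 2) + β * δ * ε ^ 2 / 2 * ‖x‖ ^ 2 := by
    have h1 := mul_le_mul_of_nonneg_left t2 (show 0 ≤ β * δ * ε by positivity)
    have hsq := mul_nonneg (mul_pos hβ hδ).le (sq_nonneg (N - ε * ‖x‖))
    linarith
  have hx2 : ‖x‖ ^ 2 ≤ 2 * W ^ 2 + 2 * M ^ 2 := by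
    have h1 : ‖x‖ ≤ W + M := by
      have := norm_add_le w z
      rw [hw, sub_add_cancel] at this
      linarith
    have := pow_le_pow_left₀ (norm_nonneg _) h1 2
    have hsq := sq_nonneg (W - M)
    linarith
  have s3 : β * δ * ε ^ 2 / 2 * ‖x‖ ^ 2
      ≤ γ * (δ * ε) / 16 * W ^ 2 + δ * ε * τ * (L * M ^ 2) := by
    have h1 : β * δ * ε ^ 2 / 2 * ‖x‖ ^ 2 ≤ β * δ * ε ^ 2 / 2 * (2 * W ^ 2 + 2 * M ^ 2) :=
      mul_le_mul_of_nonneg_left hx2 (by positivity)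
    have h2 := mul_le_mul_of_nonneg_right (hβε.trans hL) (show 0 ≤ δ * ε * W ^ 2 by positivity)
    have h3 := mul_le_mul_of_nonneg_right hβε (show 0 ≤ δ * ε * M ^ 2 by positivity)
    linarith
  -- Strong convexity of `g_t` at `x`: the source of the decay in both `Φ` and `W`.
  have s4 : Φ + ε / 2 * W ^ 2 ≤ inner ℝ n w + ε * inner ℝ x w := by
    have h1 : inner ℝ n (z - x) = -inner ℝ n w := by rw [hw, ← inner_neg_right, neg_sub]
    have h2 : ‖z‖ ^ 2 = ‖x‖ ^ 2 - 2 * inner ℝ x w + W ^ 2 := by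
      rw [← norm_sub_sq_real, hw, sub_sub_cancel]
    rw [h1] at hconv
    rw [hΦ, h2]
    linarith
  have s4' := mul_le_mul_of_nonneg_left s4 (show 0 ≤ γ / 2 * δ by positivity)
  have s5 : δ' * Φ ≤ γ / 4 * (δ * Φ) := by
    have h1 := mul_le_mul_of_nonneg_right hδ' hΦ0
    have h2 := mul_le_mul_of_nonneg_right hK₁ (mul_nonneg hδ.le hΦ0)
    linarith
  have s6 : δ * (ε' / 2 * ‖x‖ ^ 2) ≤ 0 := by
    have := mul_nonneg hδ.le (mul_nonneg (neg_nonneg.2 hε') (sq_nonneg ‖x‖))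
    linarith
  have s7 : δ * (M ^ 2 / 2) * -ε' ≤ δ * ε * τ * (K / 2 * M ^ 2) := by
    have := mul_le_mul_of_nonneg_left hK (show 0 ≤ δ * (M ^ 2 / 2) by positivity)
    linarith
  have s8 : γ' / 2 * inner ℝ v w ≤ γ / 16 * V ^ 2 + γ * (δ * ε) / 16 * W ^ 2 := by
    have h0 : -inner ℝ v w ≤ V * W := by
      linarith [neg_le_of_abs_le (abs_real_inner_le_norm v w)]
    have h1 := mul_le_mul_of_nonneg_left h0 (neg_nonneg.2 hγ'0)
    have h2 := mul_le_mul_of_nonneg_right hγ' (mul_nonneg hV0 hW0)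
    have h3 := mul_le_mul_of_nonneg_left hτ (mul_nonneg hγ.le (sq_nonneg W))
    have hsq := mul_nonneg hγ.le (sq_nonneg (V / 4 - τ * W))
    linarith
  have s9 : γ * γ' / 2 * W ^ 2 ≤ 0 := by
    have := mul_nonneg (mul_nonneg hγ.le (neg_nonneg.2 hγ'0)) (sq_nonneg W)
    linarith
  have hA : -ε' / ε * M ≤ τ * (K * M) := by
    have : -ε' / ε ≤ K * τ := by rwa [div_le_iff₀ hε]
    have := mul_le_mul_of_nonneg_right this hM0
    linarith
  set A := τ * (K * M) with hAdef
  have s10 : γ / 2 * V * (-ε' / ε * M) ≤ γ / 8 * V ^ 2 + γ * τ ^ 2 * ((K * M) ^ 2 / 2) := by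
    have h1 := mul_le_mul_of_nonneg_left hA (show 0 ≤ γ / 2 * V by positivity)
    have h2 : γ * τ ^ 2 * ((K * M) ^ 2 / 2) = γ / 2 * A ^ 2 := by rw [hAdef]; ring
    rw [h2]
    have hsq := mul_nonneg hγ.le (sq_nonneg (V / 2 - A))
    linarith
  have s11 : γ ^ 2 / 2 * W * (-ε' / ε * M)
      ≤ γ * (δ * ε) / 16 * W ^ 2 + γ ^ 3 * τ ^ 2 / (δ * ε) * (K * M) ^ 2 := by
    have h1 := mul_le_mul_of_nonneg_left hA (show 0 ≤ γ ^ 2 / 2 * W by positivity)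
    have h2 : γ ^ 3 * τ ^ 2 / (δ * ε) * (K * M) ^ 2 = γ * (γ * A) ^ 2 / (δ * ε) := by
      rw [hAdef]; ring
    -- Absorbing the path drift into the weak `W²` damping costs a division by `δε`; this term
    -- produces the exponent `3q + 2 - p`.
    have h3 : γ * (δ * ε) / 16 * W ^ 2 + γ * (γ * A) ^ 2 / (δ * ε) - γ ^ 2 / 2 * W * A
        = γ / (δ * ε) * (δ * ε / 4 * W - γ * A) ^ 2 := by
      field_simp
      ring
    have h4 : 0 ≤ γ / (δ * ε) * (δ * ε / 4 * W - γ * A) ^ 2 := by positivity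
    rw [h2]
    linarith
  have hV2 : 0 ≤ γ * V ^ 2 := by positivity
  linarith

theorem energy_upper_bound (γ Φ : ℝ) (v w : X) :
    Φ + 1 / 2 * ‖v‖ ^ 2 + γ / 2 * inner ℝ v w + γ ^ 2 / 4 * ‖w‖ ^ 2
      ≤ Φ + ‖v‖ ^ 2 + γ ^ 2 * ‖w‖ ^ 2 := by
  have h := norm_sub_sq_real v (γ • w)
  rw [real_inner_smul_right, norm_smul, mul_pow, Real.norm_eq_abs, sq_abs] at h
  nlinarith [sq_nonneg ‖v - γ • w‖, sq_nonneg ‖v‖, mul_nonneg (sq_nonneg γ) (sq_nonneg ‖w‖)]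

theorem energy_lower_bound (γ Φ : ℝ) (v w : X) :
    Φ + 1 / 8 * ‖v‖ ^ 2 + 1 / 12 * (γ ^ 2 * ‖w‖ ^ 2)
      ≤ Φ + 1 / 2 * ‖v‖ ^ 2 + γ / 2 * inner ℝ v w + γ ^ 2 / 4 * ‖w‖ ^ 2 := by
  -- The difference of the two sides is exactly `‖3v + 2γw‖² / 24`.
  have h := norm_add_sq_real ((3 : ℝ) • v) ((2 * γ) • w)
  rw [real_inner_smul_right, real_inner_smul_left, norm_smul, norm_smul, mul_pow, mul_pow,
    Real.norm_eq_abs, sq_abs, Real.norm_eq_abs, sq_abs] at h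
  nlinarith [sq_nonneg ‖(3 : ℝ) • v + (2 * γ) • w‖]

end Dissipation

end TikhonovHessian

namespace TikhonovHessian

/-! ### Asymptotics of the coefficients and of the Tikhonov parameter. -/

section Coefficients

theorem eventually_mul_rpow_le {u w : ℝ} (h : w < u) (C : ℝ) {c : ℝ} (hc : 0 < c) :
    ∀ᶠ t : ℝ in atTop, C * t ^ (-u) ≤ c * t ^ (-w) := by
  have hlim : Tendsto (fun t : ℝ => C * t ^ (-(u - w))) atTop (𝓝 (C * 0)) :=
    (tendsto_rpow_neg_atTop (sub_pos.2 h)).const_mul C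
  rw [mul_zero] at hlim
  filter_upwards [hlim.eventually_le_const hc, eventually_gt_atTop 0] with t ht ht0
  have e : t ^ (-u) = t ^ (-(u - w)) * t ^ (-w) := by
    rw [← Real.rpow_add ht0]; congr 1; ring
  rw [e, ← mul_assoc]
  exact mul_le_mul_of_nonneg_right ht (Real.rpow_nonneg ht0.le _)

/-- The Tikhonov parameter `a / (δ(t) t^p)`. -/
noncomputable def tikhonovParam (a p : ℝ) (δ : ℝ → ℝ) (t : ℝ) : ℝ := a * t ^ (-p) / δ t

variable {a p t₀ : ℝ} {δ : ℝ → ℝ}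

theorem tikhonovParam_pos (ha : 0 < a) {t : ℝ} (ht : 0 < t) (hδ : 0 < δ t) :
    0 < tikhonovParam a p δ t :=
  div_pos (mul_pos ha (Real.rpow_pos_of_pos ht _)) hδ

theorem mul_tikhonovParam {t : ℝ} (hδ : 0 < δ t) :
    δ t * tikhonovParam a p δ t = a * t ^ (-p) := by
  unfold tikhonovParam
  field_simp

theorem regularized_eq {X : Type*} [NormedAddCommGroup X] (g : X → ℝ) {t : ℝ} (ht : 0 < t) :
    regularized g a p δ t = fun z => g z + tikhonovParam a p δ t / 2 * ‖z‖ ^ 2 := by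
  funext z
  rw [regularized, tikhonovParam, Real.rpow_neg ht.le]
  congr 2
  rw [div_div, ← div_eq_mul_inv, div_div]
  congr 1
  ring

theorem antitoneOn_tikhonovParam (ha : 0 < a) (hp : 0 < p) (ht₀ : 0 < t₀)
    (hδ_pos : ∀ t, t₀ ≤ t → 0 < δ t) (hδ_mono : MonotoneOn δ (Ici t₀)) :
    AntitoneOn (tikhonovParam a p δ) (Ici t₀) := by
  intro t ht s hs hts
  have ht' : 0 < t := ht₀.trans_le ht
  unfold tikhonovParam
  refine div_le_div₀ (mul_nonneg ha.le (Real.rpow_nonneg ht'.le _)) ?_ (hδ_pos t ht)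
    (hδ_mono ht hs hts)
  exact mul_le_mul_of_nonneg_left
    (Real.rpow_le_rpow_of_nonpos ht' hts (neg_nonpos.2 hp.le)) ha.le

theorem tendsto_tikhonovParam (hp : 0 < p) (hδ_lim : Tendsto δ atTop atTop) :
    Tendsto (tikhonovParam a p δ) atTop (𝓝 0) := by
  have h1 : Tendsto (fun t : ℝ => a * t ^ (-p)) atTop (𝓝 (a * 0)) :=
    (tendsto_rpow_neg_atTop hp).const_mul a
  have := h1.mul hδ_lim.inv_tendsto_atTop
  rw [mul_zero] at this
  refine this.congr fun t => ?_
  rw [tikhonovParam, div_eq_mul_inv, Pi.inv_apply]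

theorem hasDerivWithinAt_tikhonovParam {δ' t : ℝ} {s : Set ℝ} (ht : 0 < t) (hδ : 0 < δ t)
    (h : HasDerivWithinAt δ δ' s t) :
    HasDerivWithinAt (tikhonovParam a p δ)
      (-(tikhonovParam a p δ t * (p * t ^ (-1 : ℝ) + δ' / δ t))) s t := by
  have h1 : HasDerivWithinAt (fun t : ℝ => a * t ^ (-p)) (a * (-p * t ^ (-p - 1))) s t :=
    ((Real.hasDerivAt_rpow_const (Or.inl ht.ne')).const_mul a).hasDerivWithinAt
  refine (h1.div h hδ.ne').congr_deriv ?_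
  rw [sub_eq_add_neg (-p), Real.rpow_add ht, tikhonovParam]
  field_simp
  ring

/-- The growth condition on `δ` integrates to `aβ t ≤ 2 t^p δ(t)` for large `t`. -/
theorem eventually_mul_tikhonovParam_le {β : ℝ} (ha : 0 < a) (hβ : 0 < β) (ht₀ : 0 < t₀)
    (hδ_pos : ∀ t, t₀ ≤ t → 0 < δ t) (hδ_diff : DifferentiableOn ℝ δ (Ici t₀))
    (hδ_lower : ∀ᶠ t in atTop,
      0 ≤ t ^ p * timeDeriv t₀ δ t + p * t ^ (p - 1) * δ t - a * β) :
    ∀ᶠ t in atTop, β * tikhonovParam a p δ t ≤ 2 * t ^ (-1 : ℝ) := by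
  obtain ⟨T₁, hT₁⟩ := eventually_atTop.1 hδ_lower
  set T := max T₁ t₀
  have hT0 : t₀ ≤ T := le_max_right _ _
  have hder : ∀ t, T < t → HasDerivAt (fun t => t ^ p * δ t - a * β * t)
      (t ^ p * timeDeriv t₀ δ t + p * t ^ (p - 1) * δ t - a * β) t := by
    intro t ht
    have h0 : t₀ < t := hT0.trans_lt ht
    have h1 : HasDerivAt δ (timeDeriv t₀ δ t) t :=
      (hδ_diff t h0.le).hasDerivWithinAt.hasDerivAt (Ici_mem_nhds h0)
    have h2 : HasDerivAt (fun t : ℝ => t ^ p) (p * t ^ (p - 1)) t :=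
      Real.hasDerivAt_rpow_const (Or.inl (ht₀.trans h0).ne')
    refine ((h2.mul h1).sub ((hasDerivAt_id t).const_mul (a * β))).congr_deriv ?_
    ring
  have hcont : ContinuousOn (fun t => t ^ p * δ t - a * β * t) (Ici T) := by
    refine ContinuousOn.sub (ContinuousOn.mul ?_ ?_) (by fun_prop)
    · exact continuousOn_id.rpow_const fun t ht => Or.inl (ht₀.trans_le (hT0.trans ht)).ne'
    · exact hδ_diff.continuousOn.mono (Ici_subset_Ici.2 hT0)
  have hmono : MonotoneOn (fun t => t ^ p * δ t - a * β * t) (Ici T) := by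
    refine monotoneOn_of_deriv_nonneg (convex_Ici T) hcont ?_ ?_
    · rw [interior_Ici]
      exact fun t ht => (hder t ht).differentiableAt.differentiableWithinAt
    · rw [interior_Ici]
      intro t ht
      rw [(hder t ht).deriv]
      exact hT₁ t ((le_max_left _ _).trans (le_of_lt ht))
  filter_upwards [eventually_ge_atTop (2 * T)] with t ht
  have hTpos : 0 < T := ht₀.trans_le hT0
  have htT : T ≤ t := by linarith
  have ht0 : 0 < t := hTpos.trans_le htT
  have h1 := hmono self_mem_Ici htT htT
  have h2 : 0 < T ^ p * δ T := mul_pos (Real.rpow_pos_of_pos hTpos _) (hδ_pos T hT0)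
  simp only at h1
  -- Monotonicity gives `t^p δ(t) ≥ aβ(t - T)`, and `t - T ≥ t/2` because `t ≥ 2T`.
  have h3 : a * β * t ≤ 2 * (t ^ p * δ t) := by
    have := mul_le_mul_of_nonneg_left ht (mul_pos ha hβ).le
    linarith
  have hδt := hδ_pos t (hT0.trans htT)
  have htp : 0 < t ^ p := Real.rpow_pos_of_pos ht0 _
  rw [tikhonovParam, Real.rpow_neg ht0.le, Real.rpow_neg_one]
  rw [← div_eq_mul_inv, div_div, ← mul_div_assoc, ← div_eq_mul_inv, div_le_div_iff₀ (by positivity)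
    ht0]
  linarith

end Coefficients

/-! ### Continuity of the path, dissipation rate and size of the forcing. -/

section Decay

variable {X : Type*} [NormedAddCommGroup X] [InnerProductSpace ℝ X]

theorem continuousOn_tikhonov {g : X → ℝ} (hg : ConvexOn ℝ univ g) {xbar : X}
    (hxbar : xbar ∈ argmin g) {ε : ℝ → ℝ} {t₀ : ℝ} (hε : ∀ t, t₀ ≤ t → 0 < ε t)
    (hanti : AntitoneOn ε (Ici t₀)) (hεc : ContinuousOn ε (Ici t₀)) {z : ℝ → X}
    (hz : ∀ t, t₀ ≤ t → z t ∈ argmin (fun u => g u + ε t / 2 * ‖u‖ ^ 2)) :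
    ContinuousOn z (Ici t₀) := by
  have hM : ∀ t, t₀ ≤ t → ‖z t‖ ≤ ‖xbar‖ := fun t ht =>
    norm_le_of_mem_argmin (half_pos (hε t ht)) (hz t ht) hxbar
  intro t ht
  have hεt := hε t ht
  have hkey : ∀ s, t₀ ≤ s → ‖z s - z t‖ ≤ |ε s - ε t| / ε t * ‖xbar‖ := by
    intro s hs
    have hεs := hε s hs
    rcases le_total t s with hts | hts
    · have hle := hanti ht hs hts
      refine (norm_sub_le_of_le hg (half_pos hεs) (by linarith) (hz t ht) (hz s hs)).trans ?_
      rw [← sub_div, div_div_div_cancel_right₀ two_ne_zero, abs_sub_comm,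
        abs_of_nonneg (sub_nonneg.2 hle)]
      exact mul_le_mul_of_nonneg_left (hM s hs) (div_nonneg (sub_nonneg.2 hle) hεt.le)
    · have hle := hanti hs ht hts
      rw [norm_sub_rev]
      refine (norm_sub_le_of_le hg (half_pos hεt) (by linarith) (hz s hs) (hz t ht)).trans ?_
      rw [← sub_div, div_div_div_cancel_right₀ two_ne_zero, abs_of_nonneg (sub_nonneg.2 hle)]
      exact mul_le_mul (div_le_div_of_nonneg_left (sub_nonneg.2 hle) hεt hle) (hM t ht)
        (norm_nonneg _) (div_nonneg (sub_nonneg.2 hle) hεt.le)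
  have hlim : Tendsto (fun s => |ε s - ε t| / ε t * ‖xbar‖) (𝓝[Ici t₀] t) (𝓝 0) := by
    have h1 : ContinuousWithinAt (fun s => |ε s - ε t| / ε t * ‖xbar‖) (Ici t₀) t :=
      (((hεc t ht).sub continuousWithinAt_const).abs.div_const _).mul_const _
    simpa [ContinuousWithinAt] using h1
  rw [ContinuousWithinAt, tendsto_iff_norm_sub_tendsto_zero]
  refine squeeze_zero' (Eventually.of_forall fun _ => norm_nonneg _) ?_ hlim
  filter_upwards [self_mem_nhdsWithin] with s hs using hkey s hs

/-- The terms in `φ` and `V` decay at rate `γ ~ t^(-q)`, but `γ²W²` only at rate `δε/γ ~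
t^(-(p-q))`; hence both lower bounds on `m`. -/
theorem dissipation_rate {α a m q p t φ V W E : ℝ} (hα : 0 < α) (ha : 0 < a) (ht : 1 ≤ t)
    (hqm : q ≤ m) (hpm : p - q ≤ m) (hφ : 0 ≤ φ)
    (hE : E ≤ φ + V ^ 2 + (α * t ^ (-q)) ^ 2 * W ^ 2) :
    min (α / 8) (a / (16 * α)) * t ^ (-m) * E
      ≤ α * t ^ (-q) / 8 * V ^ 2 + α * t ^ (-q) / 4 * φ
        + α * t ^ (-q) * (a * t ^ (-p)) / 16 * W ^ 2 := by
  have ht0 : 0 < t := by linarith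
  set c := min (α / 8) (a / (16 * α))
  have hc : 0 < c := lt_min (by positivity) (by positivity)
  have hm : 0 < t ^ (-m) := Real.rpow_pos_of_pos ht0 _
  have hq0 : 0 < t ^ (-q) := Real.rpow_pos_of_pos ht0 _
  have h1 : c * t ^ (-m) ≤ α / 8 * t ^ (-q) :=
    mul_le_mul (min_le_left _ _) (Real.rpow_le_rpow_of_exponent_le ht (by linarith)) hm.le
      (by positivity)
  have h2 : c * (t ^ (-m) * t ^ (-q)) ≤ a / (16 * α) * t ^ (-p) := by
    refine mul_le_mul (min_le_right _ _) ?_ (by positivity) (by positivity)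
    rw [← Real.rpow_add ht0]
    exact Real.rpow_le_rpow_of_exponent_le ht (by linarith)
  have h3 : c * t ^ (-m) * (α * t ^ (-q)) ^ 2 ≤ α * t ^ (-q) * (a * t ^ (-p)) / 16 := by
    have := mul_le_mul_of_nonneg_left h2 (show 0 ≤ α ^ 2 * t ^ (-q) by positivity)
    have e : α ^ 2 * t ^ (-q) * (a / (16 * α) * t ^ (-p)) = α * t ^ (-q) * (a * t ^ (-p)) / 16 := by
      field_simp
    linarith
  have h4 := mul_le_mul_of_nonneg_left hE (mul_pos hc hm).le
  have h5 := mul_le_mul_of_nonneg_right h1 hφ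
  have h6 := mul_le_mul_of_nonneg_right h1 (sq_nonneg V)
  have h7 := mul_le_mul_of_nonneg_right h3 (sq_nonneg W)
  have h8 : 0 ≤ α * t ^ (-q) * φ := by positivity
  linarith

theorem forcing_le {α a p q e t C₁ C₂ C₃ : ℝ} (hα : 0 < α) (ha : 0 < a) (ht : 1 ≤ t)
    (h₁ : e ≤ p + 1) (h₂ : e ≤ q + 2) (h₃ : e ≤ 3 * q + 2 - p) (hC₁ : 0 ≤ C₁) (hC₂ : 0 ≤ C₂)
    (hC₃ : 0 ≤ C₃) :
    a * t ^ (-p) * t ^ (-1 : ℝ) * C₁ + α * t ^ (-q) * (t ^ (-1 : ℝ)) ^ 2 * C₂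
        + (α * t ^ (-q)) ^ 3 * (t ^ (-1 : ℝ)) ^ 2 / (a * t ^ (-p)) * C₃
      ≤ (a * C₁ + α * C₂ + α ^ 3 / a * C₃) * t ^ (-e) := by
  have ht0 : 0 < t := by linarith
  have e1 : t ^ (-p) * t ^ (-1 : ℝ) ≤ t ^ (-e) := by
    rw [← Real.rpow_add ht0]
    exact Real.rpow_le_rpow_of_exponent_le ht (by linarith)
  have e2 : t ^ (-q) * (t ^ (-1 : ℝ)) ^ 2 ≤ t ^ (-e) := by
    rw [← Real.rpow_natCast, ← Real.rpow_mul ht0.le, ← Real.rpow_add ht0]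
    exact Real.rpow_le_rpow_of_exponent_le ht (by push_cast; linarith)
  have e3 : (t ^ (-q)) ^ 3 * (t ^ (-1 : ℝ)) ^ 2 / t ^ (-p) ≤ t ^ (-e) := by
    rw [← Real.rpow_natCast, ← Real.rpow_natCast, ← Real.rpow_mul ht0.le, ← Real.rpow_mul ht0.le,
      ← Real.rpow_add ht0, ← Real.rpow_sub ht0]
    exact Real.rpow_le_rpow_of_exponent_le ht (by push_cast; linarith)
  have f1 := mul_le_mul_of_nonneg_left e1 (show 0 ≤ a * C₁ by positivity)
  have f2 := mul_le_mul_of_nonneg_left e2 (show 0 ≤ α * C₂ by positivity)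
  have f3 := mul_le_mul_of_nonneg_left e3 (show 0 ≤ α ^ 3 / a * C₃ by positivity)
  have f3' : (α * t ^ (-q)) ^ 3 * (t ^ (-1 : ℝ)) ^ 2 / (a * t ^ (-p)) * C₃
      = α ^ 3 / a * C₃ * ((t ^ (-q)) ^ 3 * (t ^ (-1 : ℝ)) ^ 2 / t ^ (-p)) := by
    rw [mul_pow, mul_assoc (α ^ 3), mul_div_mul_comm]
    ring
  linarith

end Decay

end TikhonovHessian

namespace TikhonovHessian

/-! ### Decay of the energy along a solution. -/

section Solution

variable {X : Type*} [NormedAddCommGroup X] [InnerProductSpace ℝ X] [CompleteSpace X]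

/-- The shifted velocity `x' + β ∇g(x)`. -/
noncomputable def shiftedVelocity (g : X → ℝ) (β t₀ : ℝ) (x : ℝ → X) (t : ℝ) : X :=
  timeDeriv t₀ x t + β • gradient g (x t)

variable {g : X → ℝ} {α β a p q t₀ : ℝ} {δ : ℝ → ℝ} {x : ℝ → X}

theorem IsGlobalSolution.hasDerivWithinAt (hx : IsGlobalSolution g α β a p q t₀ δ x) {t : ℝ}
    (ht : t₀ ≤ t) : HasDerivWithinAt x (timeDeriv t₀ x t) (Ici t₀) t :=
  (hx.differentiable t ht).hasDerivWithinAt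

theorem IsGlobalSolution.hasDerivWithinAt_shiftedVelocity
    (hx : IsGlobalSolution g α β a p q t₀ δ x) (hδ : ∀ t, t₀ ≤ t → 0 < δ t) (ht₀ : 0 < t₀) {t : ℝ}
    (ht : t₀ ≤ t) :
    HasDerivWithinAt (shiftedVelocity g β t₀ x)
      (-((α * t ^ (-q)) • timeDeriv t₀ x t)
        - δ t • (gradient g (x t) + tikhonovParam a p δ t • x t)) (Ici t₀) t := by
  have ht0 : 0 < t := ht₀.trans_le ht
  have h1 : HasDerivWithinAt (timeDeriv t₀ x) (timeDeriv t₀ (timeDeriv t₀ x) t) (Ici t₀) t :=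
    (hx.differentiable_velocity t ht).hasDerivWithinAt
  have h2 : HasDerivWithinAt (fun t => gradient g (x t)) (hessian g (x t) (timeDeriv t₀ x t))
      (Ici t₀) t :=
    (hx.differentiable_gradient t ht).hasFDerivAt.comp_hasDerivWithinAt t (hx.hasDerivWithinAt ht)
  refine (h1.add (h2.const_smul β)).congr_deriv ?_
  have h3 := hx.equation t ht
  rw [smul_add, smul_smul, mul_tikhonovParam (hδ t ht), Real.rpow_neg ht0.le, Real.rpow_neg ht0.le,
    ← div_eq_mul_inv, ← div_eq_mul_inv, ← sub_eq_zero, ← h3]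
  abel

/-- Decay of the energy along a global solution. -/
theorem IsGlobalSolution.exists_energy_le (hx : IsGlobalSolution g α β a p q t₀ δ x)
    (hg : ConvexOn ℝ univ g) (hd : Differentiable ℝ g) (hα : 0 < α) (hβ : 0 < β) (ha : 0 < a)
    (ht₀ : 0 < t₀) (hq_pos : 0 < q) (hq_lt : q < 1) (hqp : q < p) (hpq : p < q + 1)
    (hδ_pos : ∀ t, t₀ ≤ t → 0 < δ t) (hδ_mono : MonotoneOn δ (Ici t₀))
    (hδ_diff : DifferentiableOn ℝ δ (Ici t₀)) (hδ_lim : Tendsto δ atTop atTop)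
    (hδ_lower : ∀ᶠ t in atTop,
      0 ≤ t ^ p * timeDeriv t₀ δ t + p * t ^ (p - 1) * δ t - a * β)
    (hδ_upper : ∃ K₁ : ℝ, 0 < K₁ ∧ ∀ᶠ t in atTop, t * timeDeriv t₀ δ t < K₁ * δ t)
    {xbar : X} (hxbar : xbar ∈ argmin g) {z : ℝ → X}
    (hz : ∀ t, t₀ ≤ t → z t ∈ argmin (fun u => g u + tikhonovParam a p δ t / 2 * ‖u‖ ^ 2))
    {m k : ℝ} (hm : m < 1) (hqm : q ≤ m) (hpm : p - q ≤ m) (hk₁ : k + m ≤ p + 1)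
    (hk₂ : k + m ≤ q + 2) (hk₃ : k + m ≤ 3 * q + 2 - p) :
    ∃ B T, 0 < B ∧ ∀ t, T ≤ t →
      energy g δ (fun t => α * t ^ (-q)) (tikhonovParam a p δ) x (shiftedVelocity g β t₀ x) z t
        ≤ B * t ^ (-k) := by
  obtain ⟨K₁, hK₁, hupper⟩ := hδ_upper
  have hp : 0 < p := hq_pos.trans hqp
  set ε := tikhonovParam a p δ with hεdef
  set γ : ℝ → ℝ := fun t => α * t ^ (-q) with hγdef
  set v := shiftedVelocity g β t₀ x with hvdef
  set M := ‖xbar‖ with hMdef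
  have hε : ∀ t, t₀ ≤ t → 0 < ε t := fun t ht =>
    tikhonovParam_pos ha (ht₀.trans_le ht) (hδ_pos t ht)
  have hγ : ∀ t, t₀ ≤ t → 0 < γ t := fun t ht =>
    mul_pos hα (Real.rpow_pos_of_pos (ht₀.trans_le ht) _)
  have hanti : AntitoneOn ε (Ici t₀) := antitoneOn_tikhonovParam ha hp ht₀ hδ_pos hδ_mono
  have hM : ∀ t, t₀ ≤ t → ‖z t‖ ≤ M := fun t ht =>
    norm_le_of_mem_argmin (half_pos (hε t ht)) (hz t ht) hxbar
  have dδ : ∀ t, t₀ ≤ t → HasDerivWithinAt δ (timeDeriv t₀ δ t) (Ici t₀) t := fun t ht =>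
    (hδ_diff t ht).hasDerivWithinAt
  have dε : ∀ t, t₀ ≤ t → HasDerivWithinAt ε
      (-(ε t * (p * t ^ (-1 : ℝ) + timeDeriv t₀ δ t / δ t))) (Ici t₀) t := fun t ht =>
    hasDerivWithinAt_tikhonovParam (ht₀.trans_le ht) (hδ_pos t ht) (dδ t ht)
  have dγ : ∀ t, t₀ ≤ t → HasDerivWithinAt γ (α * (-q * t ^ (-q - 1))) (Ici t₀) t := fun t ht =>
    ((Real.hasDerivAt_rpow_const (Or.inl (ht₀.trans_le ht).ne')).const_mul α).hasDerivWithinAt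
  have dx : ∀ t, t₀ ≤ t → HasDerivWithinAt x (timeDeriv t₀ x t) (Ici t₀) t := fun t ht =>
    hx.hasDerivWithinAt ht
  have dv := fun t (ht : t₀ ≤ t) => hx.hasDerivWithinAt_shiftedVelocity hδ_pos ht₀ ht
  have dg : ∀ t, t₀ ≤ t → HasDerivWithinAt (fun s => g (x s))
      (inner ℝ (gradient g (x t)) (timeDeriv t₀ x t)) (Ici t₀) t := by
    intro t ht
    rw [inner_gradient_left]
    exact (hd (x t)).hasFDerivAt.comp_hasDerivWithinAt t (dx t ht)
  have hzc : ContinuousOn z (Ici t₀) :=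
    continuousOn_tikhonov hg hxbar hε hanti (fun t ht => (dε t ht).continuousWithinAt) hz
  have hcont : ContinuousOn (energy g δ γ ε x v z) (Ici t₀) := by
    have c1 : ContinuousOn δ (Ici t₀) := fun t ht => (dδ t ht).continuousWithinAt
    have c2 : ContinuousOn ε (Ici t₀) := fun t ht => (dε t ht).continuousWithinAt
    have c3 : ContinuousOn γ (Ici t₀) := fun t ht => (dγ t ht).continuousWithinAt
    have c4 : ContinuousOn x (Ici t₀) := fun t ht => (dx t ht).continuousWithinAt
    have c5 : ContinuousOn v (Ici t₀) := fun t ht => (dv t ht).continuousWithinAt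
    have c6 : ContinuousOn (fun s => g (x s)) (Ici t₀) := fun t ht => (dg t ht).continuousWithinAt
    have c7 : ContinuousOn (fun s => g (z s)) (Ici t₀) := hd.continuous.comp_continuousOn hzc
    have c8 : ContinuousOn (fun s => inner ℝ (v s) (x s - z s)) (Ici t₀) := c5.inner (c4.sub hzc)
    exact (((c1.mul ((c6.add ((c2.div_const 2).mul (c4.norm.pow 2))).sub
      (c7.add ((c2.div_const 2).mul (hzc.norm.pow 2))))).add
      (continuousOn_const.mul (c5.norm.pow 2))).add ((c3.div_const 2).mul c8)).add
      (((c3.pow 2).div_const 4).mul ((c4.sub hzc).norm.pow 2))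
  have e1 : ∀ᶠ t in atTop, γ t * β ≤ δ t := by
    have h1 : Tendsto (fun t : ℝ => α * t ^ (-q) * β) atTop (𝓝 (α * 0 * β)) :=
      ((tendsto_rpow_neg_atTop hq_pos).const_mul α).mul_const β
    filter_upwards [h1.eventually_le_const (show α * 0 * β < 1 by simp),
      hδ_lim.eventually_ge_atTop 1] with t h2 h3 using h2.trans h3
  have e3 : ∀ᶠ t : ℝ in atTop, K₁ * t ^ (-1 : ℝ) ≤ α / 4 * t ^ (-q) :=
    eventually_mul_rpow_le hq_lt K₁ (by positivity)
  have e4 := eventually_mul_tikhonovParam_le ha hβ ht₀ hδ_pos hδ_diff hδ_lower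
  have e5 : ∀ᶠ t : ℝ in atTop, 2 * t ^ (-1 : ℝ) ≤ α / 16 * t ^ (-q) :=
    eventually_mul_rpow_le hq_lt 2 (by positivity)
  have e6 : ∀ᶠ t : ℝ in atTop, 1 * t ^ (-2 : ℝ) ≤ a / 16 * t ^ (-p) :=
    eventually_mul_rpow_le (by linarith) 1 (by positivity)
  obtain ⟨T, hT⟩ := eventually_atTop.1 (e1.and (hupper.and (e3.and (e4.and (e5.and (e6.and
    ((eventually_ge_atTop t₀).and (eventually_ge_atTop 1))))))))
  have hTt₀ : t₀ ≤ T := (hT T le_rfl).2.2.2.2.2.2.1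
  set c := min (α / 8) (a / (16 * α)) with hc
  have hc0 : 0 < c := lt_min (by positivity) (by positivity)
  set C := a * (((p + K₁) / 2 + 2) * M ^ 2) + α * (((p + K₁) * M) ^ 2 / 2)
    + α ^ 3 / a * ((p + K₁) * M) ^ 2 with hC
  have hC0 : 0 ≤ C := by positivity
  refine exists_le_rpow_of_dissipation (T := T)
    -- Taking `f'` to be the target bound itself makes the differential inequality trivial and moves
    -- all the work to the slope condition.
    (f' := fun t => -(c * t ^ (-m)) * energy g δ γ ε x v z t + C * t ^ (-(k + m)))
    hc0 hC0 hm (hcont.mono (Ici_subset_Ici.2 hTt₀)) ?_ (fun t _ => le_rfl)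
  intro t htT r hr
  obtain ⟨f1, f2, f3, f4, f5, f6, ht, ht1⟩ := hT t htT
  have ht0 : 0 < t := by linarith
  have hsub : Ici t ⊆ Ici t₀ := Ici_subset_Ici.2 ht
  have hder := hasDerivWithinAt_frozenEnergy (M := M) (z := z t) ((dδ t ht).mono hsub)
    ((dγ t ht).mono hsub) ((dε t ht).mono hsub) ((dx t ht).mono hsub) ((dv t ht).mono hsub)
    ((dg t ht).mono hsub)
  refine frequently_slope_lt_of_le hder ?_
    (frozenEnergy_self g δ γ ε x v z M t).symm (lt_of_le_of_lt ?_ hr)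
  · intro s hs
    have hs₀ : t₀ ≤ s := ht.trans hs
    exact energy_le_frozenEnergy hg (hδ_pos s hs₀).le (hγ s hs₀).le (hε s hs₀) (hanti ht hs₀ hs)
      (hz t ht) (hz s hs₀) (hM s hs₀)
  have hτ : 0 < t ^ (-1 : ℝ) := Real.rpow_pos_of_pos ht0 _
  have hδt := hδ_pos t ht
  have hδ'0 : 0 ≤ timeDeriv t₀ δ t := hδ_mono.derivWithin_nonneg
  have hδ' : timeDeriv t₀ δ t ≤ K₁ * t ^ (-1 : ℝ) * δ t := by
    have h1 := mul_le_mul_of_nonneg_left f2.le hτ.le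
    have h2 : t ^ (-1 : ℝ) * t = 1 := by
      rw [Real.rpow_neg_one]; exact inv_mul_cancel₀ ht0.ne'
    rw [← mul_assoc, h2, one_mul] at h1
    linarith
  have hμ : δ t * ε t = a * t ^ (-p) := mul_tikhonovParam hδt
  have hsum : p * t ^ (-1 : ℝ) + timeDeriv t₀ δ t / δ t ≤ (p + K₁) * t ^ (-1 : ℝ) := by
    have : timeDeriv t₀ δ t / δ t ≤ K₁ * t ^ (-1 : ℝ) := by rwa [div_le_iff₀ hδt]
    linarith
  have hγ' : t ^ (-q - 1) = t ^ (-q) * t ^ (-1 : ℝ) := by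
    rw [← Real.rpow_add ht0, sub_eq_add_neg]
  have hpow : 0 < t ^ (-q) * t ^ (-1 : ℝ) := mul_pos (Real.rpow_pos_of_pos ht0 _) hτ
  have hτ2 : (t ^ (-1 : ℝ)) ^ 2 = t ^ (-2 : ℝ) := by
    rw [← Real.rpow_natCast, ← Real.rpow_mul ht0.le]; norm_num
  have hineq := dissipation_inequality (x := x t) (v := v t) (z := z t) (δ := δ t) (γ := γ t)
    (ε := ε t) (n := gradient g (x t)) (gx := g (x t)) (gz := g (z t)) (τ := t ^ (-1 : ℝ))
    (K := p + K₁) (K₁ := K₁) (L := 2) (M := M) (δ' := timeDeriv t₀ δ t)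
    (γ' := α * (-q * t ^ (-q - 1)))
    (ε' := -(ε t * (p * t ^ (-1 : ℝ) + timeDeriv t₀ δ t / δ t))) (x' := timeDeriv t₀ x t)
    (β := β) (by simp [hvdef, shiftedVelocity]) rfl hδt (hγ t ht) (hε t ht) hβ (hM t ht)
    (add_inner_gradient_le hg hd _ _) (hz t ht (x t)) f1 hδ'
    (by simp only [hγdef]; linarith)
    (neg_nonpos.2 (mul_nonneg (hε t ht).le (by positivity)))
    (by rw [neg_neg]; linarith [mul_le_mul_of_nonneg_left hsum (hε t ht).le])
    f4 (by simp only [hγdef]; linarith)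
    (by rw [hγ']; have := mul_pos (mul_pos hα hq_pos) hpow; linarith)
    (by
      rw [hγ']; simp only [hγdef]
      have := mul_le_mul_of_nonneg_right hq_lt.le (mul_pos hα hpow).le
      linarith)
    (by rw [hτ2, hμ]; linarith)
  refine hineq.trans ?_
  have hφ : 0 ≤ δ t * ((g (x t) + ε t / 2 * ‖x t‖ ^ 2) - (g (z t) + ε t / 2 * ‖z t‖ ^ 2)) :=
    mul_nonneg hδt.le (sub_nonneg.2 (hz t ht (x t)))
  have hrate := dissipation_rate hα ha ht1 hqm hpm hφ
    (energy_upper_bound (γ t) _ (v t) (x t - z t))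
  have hforce := forcing_le (C₁ := ((p + K₁) / 2 + 2) * M ^ 2) (C₂ := ((p + K₁) * M) ^ 2 / 2)
    (C₃ := ((p + K₁) * M) ^ 2) hα ha ht1 hk₁ hk₂ hk₃ (by positivity) (by positivity)
    (by positivity)
  rw [hμ, neg_mul]
  exact add_le_add (neg_le_neg hrate) hforce

end Solution

end TikhonovHessian

namespace TikhonovHessian

/-! ### From energy decay to convergence rates. -/

section Rates

theorem isBigO_one_div_rpow_of_sq_le {f : ℝ → ℝ} {C k e : ℝ} (hf : ∀ t, 0 ≤ f t)
    (hk : 2 * e = k) (h : ∀ᶠ t in atTop, f t ^ 2 ≤ C * t ^ (-k)) :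
    f =O[atTop] fun t => 1 / t ^ e := by
  refine IsBigO.of_bound (√(max C 0)) ?_
  filter_upwards [h, eventually_gt_atTop 0] with t ht ht0
  have hpos : 0 < t ^ (-e) := Real.rpow_pos_of_pos ht0 _
  rw [one_div, ← Real.rpow_neg ht0.le, Real.norm_of_nonneg (hf t), Real.norm_of_nonneg hpos.le]
  refine (pow_le_pow_iff_left₀ (hf t) (by positivity) two_ne_zero).1 ?_
  rw [mul_pow, Real.sq_sqrt (le_max_right _ _), ← Real.rpow_natCast (t ^ (-e)),
    ← Real.rpow_mul ht0.le]
  have e1 : -e * ((2 : ℕ) : ℝ) = -k := by rw [← hk]; push_cast; ring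
  rw [e1]
  exact ht.trans (mul_le_mul_of_nonneg_right (le_max_left _ _) (Real.rpow_nonneg ht0.le _))

theorem tendsto_zero_of_isBigO_one_div_rpow {f : ℝ → ℝ} {e : ℝ} (he : 0 < e)
    (h : f =O[atTop] fun t => 1 / t ^ e) : Tendsto f atTop (𝓝 0) := by
  refine h.trans_tendsto ?_
  exact (tendsto_rpow_atTop he).inv_tendsto_atTop.congr fun t => (one_div _).symm

theorem isBigO_one_div_mul_rpow_of_le {f δ : ℝ → ℝ} {C k p e : ℝ} (hC : 0 ≤ C)
    (hf : ∀ t, 0 ≤ f t) (hδ : ∀ᶠ t in atTop, 0 < δ t) (hk : e ≤ k) (hp : e ≤ p)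
    (h : ∀ᶠ t in atTop, f t ≤ (C * t ^ (-k) + C * t ^ (-p)) / δ t) :
    f =O[atTop] fun t => 1 / (δ t * t ^ e) := by
  refine IsBigO.of_bound (2 * C) ?_
  filter_upwards [h, hδ, eventually_ge_atTop 1] with t ht hδt ht1
  have ht0 : 0 < t := by linarith
  have hte : 0 < t ^ e := Real.rpow_pos_of_pos ht0 _
  rw [Real.norm_of_nonneg (hf t), Real.norm_of_nonneg (by positivity)]
  refine ht.trans ?_
  have h1 : C * t ^ (-k) ≤ C * t ^ (-e) :=
    mul_le_mul_of_nonneg_left (Real.rpow_le_rpow_of_exponent_le ht1 (by linarith)) hC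
  have h2 : C * t ^ (-p) ≤ C * t ^ (-e) :=
    mul_le_mul_of_nonneg_left (Real.rpow_le_rpow_of_exponent_le ht1 (by linarith)) hC
  calc (C * t ^ (-k) + C * t ^ (-p)) / δ t ≤ (2 * C * t ^ (-e)) / δ t :=
        div_le_div_of_nonneg_right (by linarith) hδt.le
    _ = 2 * C * (1 / (δ t * t ^ e)) := by
        rw [Real.rpow_neg ht0.le]; field_simp

variable {X : Type*} [NormedAddCommGroup X] [InnerProductSpace ℝ X]

/-- The distance to the path gets two bounds, from `γ²‖w‖²` and from `δε‖w‖²`; which is sharper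
depends on the sign of `p - 2q`. The `t^(-p)` in the last bound is the regularization bias at
`xbar`. -/
theorem bounds_of_energy_le {g : X → ℝ} (hg : ConvexOn ℝ univ g) {α a p q t₀ k B T : ℝ}
    {δ : ℝ → ℝ} {x v z : ℝ → X} (hα : 0 < α) (ha : 0 < a) (ht₀ : 0 < t₀)
    (hδ_pos : ∀ t, t₀ ≤ t → 0 < δ t) (xbar : X)
    (hz : ∀ t, t₀ ≤ t → z t ∈ argmin (fun u => g u + tikhonovParam a p δ t / 2 * ‖u‖ ^ 2))
    (hB : 0 < B) (hE : ∀ t, T ≤ t →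
      energy g δ (fun t => α * t ^ (-q)) (tikhonovParam a p δ) x v z t ≤ B * t ^ (-k)) :
    ∃ C, 0 ≤ C ∧ ∀ᶠ t in atTop, ‖v t‖ ^ 2 ≤ C * t ^ (-k) ∧
      ‖x t - z t‖ ^ 2 ≤ C * t ^ (-(k - 2 * q)) ∧ ‖x t - z t‖ ^ 2 ≤ C * t ^ (-(k - p)) ∧
      g (x t) - g xbar ≤ (C * t ^ (-k) + C * t ^ (-p)) / δ t := by
  have n1 : 0 ≤ 12 * B / α ^ 2 := by positivity
  have n2 : 0 ≤ 2 * B / a := by positivity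
  have n3 : 0 ≤ a / 2 * ‖xbar‖ ^ 2 := by positivity
  set C := 8 * B + 12 * B / α ^ 2 + 2 * B / a + a / 2 * ‖xbar‖ ^ 2 with hC
  refine ⟨C, by positivity, ?_⟩
  filter_upwards [eventually_ge_atTop T, eventually_ge_atTop t₀] with t htT ht
  have ht0 : 0 < t := ht₀.trans_le ht
  have hδt := hδ_pos t ht
  set ε := tikhonovParam a p δ t with hε
  have hμ : δ t * ε = a * t ^ (-p) := mul_tikhonovParam hδt
  set Φ := (g (x t) + ε / 2 * ‖x t‖ ^ 2) - (g (z t) + ε / 2 * ‖z t‖ ^ 2) with hΦ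
  have hgrow : ε / 2 * ‖x t - z t‖ ^ 2 ≤ Φ := by
    have := add_norm_sq_le_of_mem_argmin hg (hz t ht) (x t)
    rw [hΦ]; linarith
  have hgrow' := mul_le_mul_of_nonneg_left hgrow hδt.le
  have hgrow'' : a * t ^ (-p) / 2 * ‖x t - z t‖ ^ 2 ≤ δ t * Φ := by rw [← hμ]; linarith
  have hlow := (energy_lower_bound (α * t ^ (-q)) (δ t * Φ) (v t) (x t - z t)).trans (hE t htT)
  have hk0 : 0 < t ^ (-k) := Real.rpow_pos_of_pos ht0 _
  have hp0 : 0 < t ^ (-p) := Real.rpow_pos_of_pos ht0 _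
  have hq0 : 0 < t ^ (-q) := Real.rpow_pos_of_pos ht0 _
  have hW : 0 ≤ a * t ^ (-p) / 2 * ‖x t - z t‖ ^ 2 := by positivity
  have hV : 0 ≤ ‖v t‖ ^ 2 := by positivity
  have hγW : 0 ≤ (α * t ^ (-q)) ^ 2 * ‖x t - z t‖ ^ 2 := by positivity
  refine ⟨?_, ?_, ?_, ?_⟩
  · calc ‖v t‖ ^ 2 ≤ 8 * B * t ^ (-k) := by linarith
      _ ≤ C * t ^ (-k) := mul_le_mul_of_nonneg_right (by rw [hC]; linarith) hk0.le
  · have h1 : (α * t ^ (-q)) ^ 2 * ‖x t - z t‖ ^ 2 ≤ 12 * B * t ^ (-k) := by linarith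
    have h2 : t ^ (-(k - 2 * q)) * (t ^ (-q)) ^ 2 = t ^ (-k) := by
      rw [← Real.rpow_natCast, ← Real.rpow_mul ht0.le, ← Real.rpow_add ht0]
      congr 1; push_cast; ring
    calc ‖x t - z t‖ ^ 2 ≤ 12 * B / α ^ 2 * t ^ (-(k - 2 * q)) := by
          rw [← h2] at h1
          have h3 : 0 < (α * t ^ (-q)) ^ 2 := by positivity
          refine le_of_mul_le_mul_left (h1.trans_eq ?_) h3
          field_simp
      _ ≤ C * t ^ (-(k - 2 * q)) :=
          mul_le_mul_of_nonneg_right (by rw [hC]; linarith) (Real.rpow_nonneg ht0.le _)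
  · have h1 : a * t ^ (-p) / 2 * ‖x t - z t‖ ^ 2 ≤ B * t ^ (-k) := by linarith
    have h2 : t ^ (-(k - p)) * t ^ (-p) = t ^ (-k) := by
      rw [← Real.rpow_add ht0]
      congr 1; ring
    calc ‖x t - z t‖ ^ 2 ≤ 2 * B / a * t ^ (-(k - p)) := by
          rw [← h2] at h1
          have h3 : 0 < a * t ^ (-p) / 2 := by positivity
          refine le_of_mul_le_mul_left (h1.trans_eq ?_) h3
          field_simp
      _ ≤ C * t ^ (-(k - p)) :=
          mul_le_mul_of_nonneg_right (by rw [hC]; linarith) (Real.rpow_nonneg ht0.le _)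
  · rw [le_div_iff₀ hδt]
    have h1 : δ t * Φ ≤ B * t ^ (-k) := by linarith
    have h2 : g (z t) + ε / 2 * ‖z t‖ ^ 2 ≤ g xbar + ε / 2 * ‖xbar‖ ^ 2 := hz t ht xbar
    have hε0 : 0 < ε := tikhonovParam_pos ha ht0 hδt
    have h3 : 0 ≤ ε / 2 * ‖x t‖ ^ 2 := by positivity
    have h4 : g (x t) - g xbar ≤ Φ + ε / 2 * ‖xbar‖ ^ 2 := by rw [hΦ]; linarith
    have h5 := mul_le_mul_of_nonneg_left h4 hδt.le
    have h6 : δ t * (Φ + ε / 2 * ‖xbar‖ ^ 2)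
        = δ t * Φ + a / 2 * ‖xbar‖ ^ 2 * t ^ (-p) := by
      have : δ t * (Φ + ε / 2 * ‖xbar‖ ^ 2) = δ t * Φ + δ t * ε / 2 * ‖xbar‖ ^ 2 := by ring
      rw [this, hμ]; ring
    have h7 : B * t ^ (-k) ≤ C * t ^ (-k) :=
      mul_le_mul_of_nonneg_right (by rw [hC]; linarith) hk0.le
    have h8 : a / 2 * ‖xbar‖ ^ 2 * t ^ (-p) ≤ C * t ^ (-p) :=
      mul_le_mul_of_nonneg_right (by rw [hC]; linarith) hp0.le
    linarith

end Rates

end TikhonovHessian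

/-! ### The main theorem. -/

theorem theorem3p4
    {X : Type*} [NormedAddCommGroup X] [InnerProductSpace ℝ X] [CompleteSpace X]
    (g : X → ℝ) (hg_convex : ConvexOn ℝ univ g) (hg_diff : Differentiable ℝ g)
    (hg_argmin : (TikhonovHessian.argmin g).Nonempty)
    (α β a p q t₀ : ℝ) (hα : 0 < α) (hβ : 0 < β) (ha : 0 < a) (ht₀ : 0 < t₀)
    (hq_pos : 0 < q) (hq_lt : q < 1) (hqp : q < p) (hpq : p < q + 1)
    (δ : ℝ → ℝ) (hδ_pos : ∀ t, t₀ ≤ t → 0 < δ t) (hδ_mono : MonotoneOn δ (Ici t₀))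
    (hδ_diff : DifferentiableOn ℝ δ (Ici t₀)) (hδ_lim : Tendsto δ atTop atTop)
    (hδ_lower : ∀ᶠ t in atTop,
      0 ≤ t ^ p * TikhonovHessian.timeDeriv t₀ δ t + p * t ^ (p - 1) * δ t - a * β)
    (hδ_upper : ∃ K₁ : ℝ, 0 < K₁ ∧
      ∀ᶠ t in atTop, t * TikhonovHessian.timeDeriv t₀ δ t < K₁ * δ t)
    (x : ℝ → X) (hx : TikhonovHessian.IsGlobalSolution g α β a p q t₀ δ x) :
    ∃ (xbar : X) (xreg : ℝ → X),
      -- `xbar` is the unique minimum-norm minimizer of `g`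
      (∀ z, TikhonovHessian.IsMinNormMinimizer g z ↔ z = xbar) ∧
      -- `xreg t` is the unique minimizer of the regularized function `g_t`
      (∀ t, t₀ ≤ t → ∀ z,
        z ∈ TikhonovHessian.argmin (TikhonovHessian.regularized g a p δ t) ↔ z = xreg t) ∧
      -- strong convergence
      Tendsto (fun t => ‖x t - xbar‖) atTop (𝓝 0) ∧
      -- rates for `q < p < (3q+1)/2`
      (p < (3 * q + 1) / 2 →
        ((fun t => ‖TikhonovHessian.timeDeriv t₀ x t + β • gradient g (x t)‖)
            =O[atTop] fun t => 1 / t ^ ((p + 1 - max q (p - q)) / 2)) ∧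
        ((fun t => ‖x t - xreg t‖) =O[atTop] fun t => 1 / t ^ ((1 - q) / 2)) ∧
        ((fun t => g (x t) - g xbar) =O[atTop] fun t => 1 / (δ t * t ^ p))) ∧
      -- rates for `(3q+1)/2 ≤ p < q+1`
      ((3 * q + 1) / 2 ≤ p →
        ((fun t => ‖TikhonovHessian.timeDeriv t₀ x t + β • gradient g (x t)‖)
            =O[atTop] fun t => 1 / t ^ (2 * q - p + 1)) ∧
        ((fun t => ‖x t - xreg t‖) =O[atTop] fun t => 1 / t ^ (q - p + 1)) ∧
        (p ≤ (4 * q + 2) / 3 →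
          (fun t => g (x t) - g xbar) =O[atTop] fun t => 1 / (δ t * t ^ p)) ∧
        ((4 * q + 2) / 3 < p →
          (fun t => g (x t) - g xbar)
            =O[atTop] fun t => 1 / (δ t * t ^ (4 * q - 2 * p + 2)))) := by
  have hp : 0 < p := hq_pos.trans hqp
  obtain ⟨xbar, hxbar⟩ := TikhonovHessian.exists_isMinNormMinimizer hg_convex hg_diff.continuous
    hg_argmin
  have hεpos : ∀ t, t₀ ≤ t → 0 < TikhonovHessian.tikhonovParam a p δ t := fun t ht =>
    TikhonovHessian.tikhonovParam_pos ha (ht₀.trans_le ht) (hδ_pos t ht)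
  have hex : ∀ t, ∃ z : X, t₀ ≤ t → z ∈ TikhonovHessian.argmin
      (fun u => g u + TikhonovHessian.tikhonovParam a p δ t / 2 * ‖u‖ ^ 2) := by
    intro t
    by_cases ht : t₀ ≤ t
    · obtain ⟨z, hz⟩ := TikhonovHessian.exists_mem_argmin hg_convex hg_diff.continuous hg_argmin
        (half_pos (hεpos t ht))
      exact ⟨z, fun _ => hz⟩
    · exact ⟨0, fun h => absurd h ht⟩
  choose z hz using hex
  have hbounds : ∀ m k : ℝ, m < 1 → q ≤ m → p - q ≤ m → k + m ≤ p + 1 → k + m ≤ q + 2 →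
      k + m ≤ 3 * q + 2 - p → ∃ C, 0 ≤ C ∧ ∀ᶠ t in atTop,
        ‖TikhonovHessian.timeDeriv t₀ x t + β • gradient g (x t)‖ ^ 2 ≤ C * t ^ (-k) ∧
        ‖x t - z t‖ ^ 2 ≤ C * t ^ (-(k - 2 * q)) ∧ ‖x t - z t‖ ^ 2 ≤ C * t ^ (-(k - p)) ∧
        g (x t) - g xbar ≤ (C * t ^ (-k) + C * t ^ (-p)) / δ t := by
    intro m k hm hqm hpm h₁ h₂ h₃
    obtain ⟨B, T, hB, hE⟩ := hx.exists_energy_le hg_convex hg_diff hα hβ ha ht₀ hq_pos hq_lt hqp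
      hpq hδ_pos hδ_mono hδ_diff hδ_lim hδ_lower hδ_upper hxbar.1 hz hm hqm hpm h₁ h₂ h₃
    exact TikhonovHessian.bounds_of_energy_le hg_convex hα ha ht₀ hδ_pos xbar hz hB hE
  have hδev : ∀ᶠ t in atTop, 0 < δ t := by
    filter_upwards [eventually_ge_atTop t₀] with t ht using hδ_pos t ht
  have hg0 : ∀ t, 0 ≤ g (x t) - g xbar := fun t => sub_nonneg.2 (hxbar.1 (x t))
  have hslow : p < (3 * q + 1) / 2 →
        ((fun t => ‖TikhonovHessian.timeDeriv t₀ x t + β • gradient g (x t)‖)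
            =O[atTop] fun t => 1 / t ^ ((p + 1 - max q (p - q)) / 2)) ∧
        ((fun t => ‖x t - z t‖) =O[atTop] fun t => 1 / t ^ ((1 - q) / 2)) ∧
        ((fun t => g (x t) - g xbar) =O[atTop] fun t => 1 / (δ t * t ^ p)) := by
    intro hps
    have hm1 : max q (p - q) < 1 := max_lt hq_lt (by linarith)
    -- Here `p + 1 ≤ 3q + 2 - p`, so `k + m = p + 1`. Either value of the maximum yields `1 - q` for
    -- the squared distance.
    obtain ⟨C, hC, h⟩ := hbounds (max q (p - q)) (p + 1 - max q (p - q)) hm1 (le_max_left _ _)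
      (le_max_right _ _) (by linarith) (by linarith) (by linarith)
    refine ⟨TikhonovHessian.isBigO_one_div_rpow_of_sq_le (fun t => norm_nonneg _) (by ring)
      (h.mono fun t ht => ht.1), ?_, TikhonovHessian.isBigO_one_div_mul_rpow_of_le hC hg0 hδev
      (by linarith) le_rfl (h.mono fun t ht => ht.2.2.2)⟩
    rcases le_total q (p - q) with hle | hle
    · rw [max_eq_right hle] at h
      exact TikhonovHessian.isBigO_one_div_rpow_of_sq_le (fun t => norm_nonneg _) (by ring)
        (h.mono fun t ht => ht.2.1)
    · rw [max_eq_left hle] at h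
      exact TikhonovHessian.isBigO_one_div_rpow_of_sq_le (fun t => norm_nonneg _) (by ring)
        (h.mono fun t ht => ht.2.2.1)
  have hfast : (3 * q + 1) / 2 ≤ p →
        ((fun t => ‖TikhonovHessian.timeDeriv t₀ x t + β • gradient g (x t)‖)
            =O[atTop] fun t => 1 / t ^ (2 * q - p + 1)) ∧
        ((fun t => ‖x t - z t‖) =O[atTop] fun t => 1 / t ^ (q - p + 1)) ∧
        (p ≤ (4 * q + 2) / 3 →
          (fun t => g (x t) - g xbar) =O[atTop] fun t => 1 / (δ t * t ^ p)) ∧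
        ((4 * q + 2) / 3 < p →
          (fun t => g (x t) - g xbar)
            =O[atTop] fun t => 1 / (δ t * t ^ (4 * q - 2 * p + 2))) := by
    intro hps
    -- Now `p ≥ (3q+1)/2 > 2q`, so `m = p - q` and `k + m = 3q + 2 - p`. The threshold `(4q+2)/3` is
    -- where `k = p`.
    obtain ⟨C, hC, h⟩ := hbounds (p - q) (4 * q + 2 - 2 * p) (by linarith) (by linarith) le_rfl
      (by linarith) (by linarith) (by linarith)
    exact ⟨TikhonovHessian.isBigO_one_div_rpow_of_sq_le (fun t => norm_nonneg _) (by ring)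
        (h.mono fun t ht => ht.1),
      TikhonovHessian.isBigO_one_div_rpow_of_sq_le (fun t => norm_nonneg _) (by ring)
        (h.mono fun t ht => ht.2.1),
      fun hp1 => TikhonovHessian.isBigO_one_div_mul_rpow_of_le hC hg0 hδev (by linarith) le_rfl
        (h.mono fun t ht => ht.2.2.2),
      fun hp1 => TikhonovHessian.isBigO_one_div_mul_rpow_of_le hC hg0 hδev (by linarith)
        (by linarith) (h.mono fun t ht => ht.2.2.2)⟩
  refine ⟨xbar, z, fun y => ⟨fun hy => hxbar.eq hg_convex hy, fun hy => hy ▸ hxbar⟩,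
    fun t ht y => ?_, ?_, hslow, hfast⟩
  · rw [TikhonovHessian.regularized_eq g (ht₀.trans_le ht)]
    exact ⟨fun hy => TikhonovHessian.eq_of_mem_argmin hg_convex (half_pos (hεpos t ht)) (hz t ht) hy,
      fun hy => hy ▸ hz t ht⟩
  · have hxz : Tendsto (fun t => ‖x t - z t‖) atTop (𝓝 0) := by
      rcases lt_or_ge p ((3 * q + 1) / 2) with h | h
      · exact TikhonovHessian.tendsto_zero_of_isBigO_one_div_rpow (by linarith) (hslow h).2.1
      · exact TikhonovHessian.tendsto_zero_of_isBigO_one_div_rpow (by linarith) (hfast h).2.1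
    have hzbar : Tendsto z atTop (𝓝 xbar) := by
      have hanti := TikhonovHessian.antitoneOn_tikhonovParam ha hp ht₀ hδ_pos hδ_mono
      refine TikhonovHessian.tendsto_tikhonov hg_convex hg_diff.continuous hxbar
        (fun t ht => half_pos (hεpos t ht))
        (fun t ht s hs hts => div_le_div_of_nonneg_right (hanti ht hs hts) zero_le_two) ?_ hz
      simpa using (TikhonovHessian.tendsto_tikhonovParam hp hδ_lim).div_const 2
    have h1 := (tendsto_zero_iff_norm_tendsto_zero.2 hxz).add
      (tendsto_sub_nhds_zero_iff.2 hzbar)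
    simpa using h1.norm
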